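/- Let $\Omega,\Lambda,\gamma\in\mathbb{R}$ with $\Omega\neq0$, $\gamma\notin\{0,1\}$, and let $Q\in\mathbb{C}$, $Q\neq 0$, satisfy $Q^2=4(i\Omega+\gamma\Omega\Lambda)+(1-i\gamma\Omega-i\Lambda)^2$. Let $k_t,k_p\in\mathbb{C}$ have positive imaginary part and satisfy $$k_t^2=\frac{i}{2\Omega}\,\frac{1-i\gamma\Omega-i\Lambda+Q}{1-i\gamma\Lambda},\qquad k_p^2=\frac{i}{2\Omega}\,\frac{1-i\gamma\Omega-i\Lambda-Q}{1-i\gamma\Lambda},$$ and put $m_t=\frac{\gamma}{\gamma-1}(1+i\Omega k_t^2)$, $m_p=\frac{\gamma}{\gamma-1}(1+i\Omega k_p^2)$. Let $J_0$ be the Bessel function of order zero, $H_0^{(1)}=J_0+iY_0$ the Hankel function, and $j_0(z)=\sin z/z$, $h_0^{(1)}(z)=-ie^{iz}/z$ the spherical ones. For $d=2$ let $U_2$ be the complex span of the four radial pairs $(T,P)=\big(f(kr),\,m f(kr)\big)$ with $f\in\{J_0,H_0^{(1)}\}$ and $(k,m)\in\{(k_p,m_p),(k_t,m_t)\}$; for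 $d=3$ let $U_3$ be defined in the same way with $f\in\{j_0,h_0^{(1)}\}$. Consider on $\mathbb{R}^d$ ($d=2,3$) the Morse–Ingard system with a delta source, $$\Omega\nabla^2T+iT-i\tfrac{\gamma-1}{\gamma}P=\delta,$$ $$(1-i\gamma\Lambda)\nabla^2P+\Big[\gamma\big(1-\tfrac{\Lambda}{\Omega}\big)+\tfrac{\Lambda}{\Omega}\Big]P-\gamma\big(1-\tfrac{\Lambda}{\Omega}\big)T=-i\gamma\tfrac{\Lambda}{\Omega}\,\delta,$$ understood in the weak sense: $T,P$ are locally integrable and the equations hold after pairing with every $\varphi\in C_c^\infty(\mathbb{R}^d;\mathbb{C})$, all derivatives being moved onto $\varphi$. A free-space Green's function in $U_d$ is a pair $(T,P)\in U_d$, regarded as functions of $r=|x|$, that solves this system in the weak sense and is such that $T$ and $P$ stay bounded as $|x|\to\infty$. Then there is exactly one free-space Green's function in each of $U_2$ and $U_3$. In 2D it is $$G_T=b_1H_0^{(1)}(k_pr)+b_2H_0^{(1)}(k_tr),\qquad G_P=b_1m_pH_0^{(1)}(k_pr)+b_2m_tH_0^{(1)}(k_tr),$$ $$b_1=\frac{\gamma-1}{4\gamma\Omega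 Q}\,[\,im_t+(m_t-1)\gamma\Lambda\,],\qquad b_2=-\frac{\gamma-1}{4\gamma\Omega Q}\,[\,im_p+(m_p-1)\gamma\Lambda\,].$$ In 3D it is $$G_T=c_1h_0^{(1)}(k_pr)+c_2h_0^{(1)}(k_tr),\qquad G_P=c_1m_ph_0^{(1)}(k_pr)+c_2m_th_0^{(1)}(k_tr),$$ $$c_1=\frac{k_p(\gamma-1)}{4\pi\gamma\Omega Q}\,[\,im_t+(m_t-1)\gamma\Lambda\,],\qquad c_2=-\frac{k_t(\gamma-1)}{4\pi\gamma\Omega Q}\,[\,im_p+(m_p-1)\gamma\Lambda\,].$$ -/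

import Mathlib

open scoped ContDiff

noncomputable section

namespace MorseIngard

/-! ### Bessel and Hankel functions of order zero -/

/-- The Bessel function `J₀` of the first kind of order zero, by its (everywhere convergent)
power series. -/
def besselJ0 (z : ℂ) : ℂ :=
  ∑' n : ℕ, (-1) ^ n * (z ^ 2 / 4) ^ n / ((n.factorial : ℂ) ^ 2)

/-- The Bessel function `Y₀` of the second kind of order zero (principal branch, cut along the
non-positive real axis). -/
def besselY0 (z : ℂ) : ℂ :=
  (2 / Real.pi) *
    ((Complex.log (z / 2) + Real.eulerMascheroniConstant) * besselJ0 z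
      - ∑' n : ℕ, (-1) ^ n * ((harmonic n : ℚ) : ℂ) * (z ^ 2 / 4) ^ n
          / ((n.factorial : ℂ) ^ 2))

/-- The Hankel function `H₀⁽¹⁾ = J₀ + i Y₀` of the first kind of order zero. -/
def hankelH0 (z : ℂ) : ℂ := besselJ0 z + Complex.I * besselY0 z

/-- The spherical Bessel function `j₀(z) = sin z / z` (the value at `z = 0` plays no role). -/
def sphBesselJ0 (z : ℂ) : ℂ := Complex.sin z / z

/-- The spherical Bessel function `y₀(z) = - cos z / z`. -/
def sphBesselY0 (z : ℂ) : ℂ := -(Complex.cos z / z)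

/-- The spherical Hankel function `h₀⁽¹⁾ = j₀ + i y₀` of the first kind of order zero. -/
def sphHankelH0 (z : ℂ) : ℂ := sphBesselJ0 z + Complex.I * sphBesselY0 z

/-! ### The Morse-Ingard system -/

/-- The Euclidean space `ℝ^d`. -/
abbrev E (d : ℕ) : Type := EuclideanSpace ℝ (Fin d)

/-- `(T, P)` solves, in the weak (distributional) sense on the whole of `ℝ^d`, the Morse-Ingard
system with source `S = δ`, the Dirac mass at the origin:
`Ω ∇²T + i T - i (γ-1)/γ P = δ` and
`(1 - iγΛ) ∇²P + [γ(1 - Λ/Ω) + Λ/Ω] P - γ(1 - Λ/Ω) T = - i γ (Λ/Ω) δ`. -/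
def IsWeakDeltaSolution (d : ℕ) (Ω Λ γ : ℝ) (T P : E d → ℂ) : Prop :=
  MeasureTheory.LocallyIntegrable T ∧ MeasureTheory.LocallyIntegrable P ∧
  ∀ φ : E d → ℂ, ContDiff ℝ ∞ φ → HasCompactSupport φ →
    (∫ x, (Ω * T x * Laplacian.laplacian φ x
        + (Complex.I * T x - Complex.I * ((γ - 1) / γ) * P x) * φ x)) = φ 0 ∧
    (∫ x, ((1 - Complex.I * γ * Λ) * P x * Laplacian.laplacian φ x
        + ((γ * (1 - Λ / Ω) + Λ / Ω) * P x - γ * (1 - Λ / Ω) * T x) * φ x))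
      = -Complex.I * γ * (Λ / Ω) * φ 0

/-- `F` stays bounded as `|x| → ∞`. -/
def BoundedAtInfinity {d : ℕ} (F : E d → ℂ) : Prop :=
  ∃ C : ℝ, ∀ᶠ x in Bornology.cobounded (E d), ‖F x‖ ≤ C

/-! ### Thermal and acoustic modes

A radial pair of fields is given by its profile `r ↦ (T(r), P(r))`. -/

/-- The square `k_t²` of the thermal wave number. -/
def thermalWavenumberSq (Ω Λ γ : ℝ) (Q : ℂ) : ℂ :=
  Complex.I / (2 * Ω)
    * ((1 - Complex.I * γ * Ω - Complex.I * Λ + Q) / (1 - Complex.I * γ * Λ))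

/-- The square `k_p²` of the acoustic wave number. -/
def acousticWavenumberSq (Ω Λ γ : ℝ) (Q : ℂ) : ℂ :=
  Complex.I / (2 * Ω)
    * ((1 - Complex.I * γ * Ω - Complex.I * Λ - Q) / (1 - Complex.I * γ * Λ))

/-- The ratio `m = γ/(γ-1) (1 + iΩk²)` of pressure to temperature in the mode of wave
number `k`. -/
def modeRatio (Ω γ : ℝ) (k : ℂ) : ℂ :=
  (γ : ℂ) / (γ - 1) * (1 + Complex.I * Ω * k ^ 2)

/-- The radial mode `r ↦ (f(kr), m f(kr))`. -/
def mode (Ω γ : ℝ) (f : ℂ → ℂ) (k : ℂ) : ℝ → ℂ × ℂ :=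
  fun r => (f (k * r), modeRatio Ω γ k * f (k * r))

/-- The fundamental set `U₂` of radial solutions of the homogeneous system in 2D. -/
def U2 (Ω γ : ℝ) (kp kt : ℂ) : Submodule ℂ (ℝ → ℂ × ℂ) :=
  Submodule.span ℂ
    {mode Ω γ besselJ0 kp, mode Ω γ hankelH0 kp, mode Ω γ besselJ0 kt, mode Ω γ hankelH0 kt}

/-- The fundamental set `U₃` of radial solutions of the homogeneous system in 3D. -/
def U3 (Ω γ : ℝ) (kp kt : ℂ) : Submodule ℂ (ℝ → ℂ × ℂ) :=
  Submodule.span ℂ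
    {mode Ω γ sphBesselJ0 kp, mode Ω γ sphHankelH0 kp,
     mode Ω γ sphBesselJ0 kt, mode Ω γ sphHankelH0 kt}

/-- The radial pair with profile `G`, in the set `U` of radial pairs on `ℝ^d`, is a free-space
Green's function that is bounded at infinity. -/
def IsFreeSpaceGreen (d : ℕ) (Ω Λ γ : ℝ) (U : Submodule ℂ (ℝ → ℂ × ℂ)) (G : ℝ → ℂ × ℂ) : Prop :=
  G ∈ U ∧
  IsWeakDeltaSolution d Ω Λ γ (fun x => (G ‖x‖).1) (fun x => (G ‖x‖).2) ∧
  BoundedAtInfinity (fun x : E d => (G ‖x‖).1) ∧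
  BoundedAtInfinity (fun x : E d => (G ‖x‖).2)

/-! ### The explicit coefficients and the Green's functions -/

/-- The coefficient `b₁` of the acoustic mode in 2D. -/
def b1 (Ω Λ γ : ℝ) (Q kt : ℂ) : ℂ :=
  (γ - 1) / (4 * γ * Ω * Q)
    * (Complex.I * modeRatio Ω γ kt + (modeRatio Ω γ kt - 1) * γ * Λ)

/-- The coefficient `b₂` of the thermal mode in 2D. -/
def b2 (Ω Λ γ : ℝ) (Q kp : ℂ) : ℂ :=
  -((γ - 1) / (4 * γ * Ω * Q)
    * (Complex.I * modeRatio Ω γ kp + (modeRatio Ω γ kp - 1) * γ * Λ))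

/-- The coefficient `c₁` of the acoustic mode in 3D. -/
def c1 (Ω Λ γ : ℝ) (Q kp kt : ℂ) : ℂ :=
  kp * (γ - 1) / (4 * Real.pi * γ * Ω * Q)
    * (Complex.I * modeRatio Ω γ kt + (modeRatio Ω γ kt - 1) * γ * Λ)

/-- The coefficient `c₂` of the thermal mode in 3D. -/
def c2 (Ω Λ γ : ℝ) (Q kp kt : ℂ) : ℂ :=
  -(kt * (γ - 1) / (4 * Real.pi * γ * Ω * Q)
    * (Complex.I * modeRatio Ω γ kp + (modeRatio Ω γ kp - 1) * γ * Λ))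

/-- The pair `(G_T, G_P)` in 2D, as a function of `r`. -/
def green2 (Ω Λ γ : ℝ) (Q kp kt : ℂ) : ℝ → ℂ × ℂ := fun r =>
  (b1 Ω Λ γ Q kt * hankelH0 (kp * r) + b2 Ω Λ γ Q kp * hankelH0 (kt * r),
   b1 Ω Λ γ Q kt * modeRatio Ω γ kp * hankelH0 (kp * r)
    + b2 Ω Λ γ Q kp * modeRatio Ω γ kt * hankelH0 (kt * r))

/-- The pair `(G_T, G_P)` in 3D, as a function of `r`. -/
def green3 (Ω Λ γ : ℝ) (Q kp kt : ℂ) : ℝ → ℂ × ℂ := fun r =>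
  (c1 Ω Λ γ Q kp kt * sphHankelH0 (kp * r) + c2 Ω Λ γ Q kp kt * sphHankelH0 (kt * r),
   c1 Ω Λ γ Q kp kt * modeRatio Ω γ kp * sphHankelH0 (kp * r)
    + c2 Ω Λ γ Q kp kt * modeRatio Ω γ kt * sphHankelH0 (kt * r))

end MorseIngard

end

namespace MorseIngard

open MeasureTheory Filter Topology Set Asymptotics

/-! ### Radial fundamental solutions of the Helmholtz equation -/

/-! ### Integration by parts against a test function. -/

section IntegrationByParts

variable {V ι : Type*} [NormedAddCommGroup V] [InnerProductSpace ℝ V] [FiniteDimensional ℝ V]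
  [Fintype ι]

/-! Each mode (f(kr), m f(kr)) decouples the system. Since k² is a root of the dispersion quadratic
and m is the matching ratio, the zeroth-order terms of the two equations reduce on the mode to Ω k²
T and (1 - iγΛ) k² P (`modeRatio_temperature`, `modeRatio_pressure`). Both equations therefore
become multiples of the Helmholtz operator Δ + k². If (Δ + k²) h(k|x|) = σ(k) δ, a combination of
the two h-modes with coefficients a, b solves the system exactly when A = a σ(k_p) and B = b σ(k_t)
satisfy two scalar linear equations. These have a unique solution because m_t - m_p = -γQ / ((γ-1)(1
- iγΛ)) is nonzero.

The modes built on J₀ or j₀ are excluded by boundedness: m_t T - P and P - m_p T each isolate one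
wave number, and for Im k > 0 the Hankel function stays bounded along the ray while the Bessel
function does not.

Two analytic inputs remain. The first is the delta mass of a radial Helmholtz solution
(`integral_radial_mul_helmholtz`): replace |x| by √(|x|² + δ²), apply Δ + k² classically, rescale by
δ, and let δ → 0; the result depends only on the limit of r^{d-1} F'(r).

The second is the growth of J₀ and H₀⁽¹⁾, which the power series do not show. For Im z > 0, πi
H₀⁽¹⁾(z) = ∫ e^{iz cosh t} dt (`hankelH0_eq_coshIntegral`), because both sides solve Bessel's
equation and have the same singular behaviour at 0. The integral gives exponential decay of H₀⁽¹⁾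
and its derivative along rays. The Wronskian of J₀ and H₀⁽¹⁾ is 2i/(πz), and this forces J₀ to be
unbounded there (`not_bounded_besselJ0_ray`). In dimension three everything is elementary. -/

theorem continuous_laplacian {φ : V → ℂ} (hφ : ContDiff ℝ ∞ φ) :
    Continuous (Laplacian.laplacian φ) := by
  rw [InnerProductSpace.laplacian_eq_iteratedFDeriv_stdOrthonormalBasis]
  have h : Continuous (iteratedFDeriv ℝ 2 φ) := hφ.continuous_iteratedFDeriv (WithTop.coe_le_coe.2 le_top)
  exact continuous_finsetSum _ fun i _ =>
    (ContinuousMultilinearMap.apply ℝ (fun _ : Fin 2 => V) ℂ _).continuous.comp h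

theorem hasCompactSupport_laplacian {φ : V → ℂ} (hφ : HasCompactSupport φ) :
    HasCompactSupport (Laplacian.laplacian φ) := by
  rw [InnerProductSpace.laplacian_eq_iteratedFDeriv_stdOrthonormalBasis]
  refine (hφ.iteratedFDeriv (𝕜 := ℝ) 2).mono fun x hx h => hx ?_
  simp only [h]
  simp

variable [MeasurableSpace V] [BorelSpace V]

/-- Two integrations by parts along `v`; the compact support of φ removes the boundary terms. Only
line derivatives of `f` are required, which suits a function of the regularized radius,
differentiated one coordinate at a time. -/
theorem integral_mul_iterated_lineDeriv {f f' f'' φ : V → ℂ} (v : V)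
    (hf : ∀ x, HasLineDerivAt ℝ f (f' x) x v) (hf' : ∀ x, HasLineDerivAt ℝ f' (f'' x) x v)
    (hfc : Continuous f) (hfc' : Continuous f') (hfc'' : Continuous f'')
    (hφ : ContDiff ℝ ∞ φ) (hφs : HasCompactSupport φ) :
    ∫ x, f x * iteratedFDeriv ℝ 2 φ x ![v, v] = ∫ x, f'' x * φ x := by
  have hφ1 : ContDiff ℝ ∞ (fun x => fderiv ℝ φ x v) :=
    (hφ.fderiv_right (m := ∞) (by simp)).clm_apply contDiff_const
  have hφ2 : ContDiff ℝ ∞ (fun x => fderiv ℝ (fun x => fderiv ℝ φ x v) x v) :=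
    (hφ1.fderiv_right (m := ∞) (by simp)).clm_apply contDiff_const
  have hs1 : HasCompactSupport (fun x => fderiv ℝ φ x v) := hφs.fderiv_apply (𝕜 := ℝ) v
  have hs2 : HasCompactSupport (fun x => fderiv ℝ (fun x => fderiv ℝ φ x v) x v) :=
    hs1.fderiv_apply (𝕜 := ℝ) v
  have e : ∀ x, iteratedFDeriv ℝ 2 φ x ![v, v] = fderiv ℝ (fun x => fderiv ℝ φ x v) x v := by
    intro x
    have hd : DifferentiableAt ℝ (fderiv ℝ φ) x :=
      (hφ.fderiv_right (m := ∞) (by simp)).differentiable (by simp) x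
    rw [iteratedFDeriv_two_apply, fderiv_clm_apply hd (by fun_prop)]
    simp
  have int : ∀ {a b : V → ℂ}, Continuous a → Continuous b → HasCompactSupport b →
      Integrable (fun x => ContinuousLinearMap.mul ℝ ℂ (a x) (b x)) := fun ha hb hs =>
    (ha.mul hb).integrable_of_hasCompactSupport hs.mul_left
  have l1 : ∀ x, HasLineDerivAt ℝ φ (fderiv ℝ φ x v) x v := fun x =>
    ((hφ.differentiable (by simp)) x).hasFDerivAt.hasLineDerivAt v
  have l2 : ∀ x, HasLineDerivAt ℝ (fun x => fderiv ℝ φ x v)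
      (fderiv ℝ (fun x => fderiv ℝ φ x v) x v) x v := fun x =>
    ((hφ1.differentiable (by simp)) x).hasFDerivAt.hasLineDerivAt v
  have h1 := integral_bilinear_hasLineDerivAt_right_eq_neg_left_of_integrable (μ := volume)
    (B := ContinuousLinearMap.mul ℝ ℂ) (int hfc' hφ1.continuous hs1)
    (int hfc hφ2.continuous hs2) (int hfc hφ1.continuous hs1) (fun x _ => hf x) (fun x _ => l2 x)
  have h2 := integral_bilinear_hasLineDerivAt_right_eq_neg_left_of_integrable (μ := volume)
    (B := ContinuousLinearMap.mul ℝ ℂ) (int hfc'' hφ.continuous hφs)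
    (int hfc' hφ1.continuous hs1) (int hfc' hφ.continuous hφs) (fun x _ => hf' x) (fun x _ => l1 x)
  simp only [ContinuousLinearMap.mul_apply'] at h1 h2
  simp only [e]
  rw [h1, h2, neg_neg]

theorem integral_mul_laplacian {f : V → ℂ} {f' f'' : ι → V → ℂ} {φ : V → ℂ}
    (b : OrthonormalBasis ι ℝ V)
    (hf : ∀ i x, HasLineDerivAt ℝ f (f' i x) x (b i))
    (hf' : ∀ i x, HasLineDerivAt ℝ (f' i) (f'' i x) x (b i))
    (hfc : Continuous f) (hfc' : ∀ i, Continuous (f' i)) (hfc'' : ∀ i, Continuous (f'' i))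
    (hφ : ContDiff ℝ ∞ φ) (hφs : HasCompactSupport φ) :
    ∫ x, f x * Laplacian.laplacian φ x = ∫ x, (∑ i, f'' i x) * φ x := by
  rw [InnerProductSpace.laplacian_eq_iteratedFDeriv_orthonormalBasis φ b]
  simp only [Finset.mul_sum, Finset.sum_mul]
  rw [integral_finsetSum, integral_finsetSum]
  · exact Finset.sum_congr rfl fun i _ => integral_mul_iterated_lineDeriv (b i) (hf i) (hf' i)
      hfc (hfc' i) (hfc'' i) hφ hφs
  · exact fun i _ => ((hfc'' i).mul hφ.continuous).integrable_of_hasCompactSupport hφs.mul_left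
  · intro i _
    have h : Continuous (iteratedFDeriv ℝ 2 φ) := hφ.continuous_iteratedFDeriv (WithTop.coe_le_coe.2 le_top)
    refine (hfc.mul ((ContinuousMultilinearMap.apply ℝ (fun _ : Fin 2 => V) ℂ
      ![b i, b i]).continuous.comp h)).integrable_of_hasCompactSupport ?_
    refine HasCompactSupport.mul_left ((hφs.iteratedFDeriv (𝕜 := ℝ) 2).mono fun x hx h => hx ?_)
    simp [h]

end IntegrationByParts

/-! #### The regularized radius -/

/-- The regularized radius `√(|x|² + δ²)`. -/
noncomputable def regRadius {d : ℕ} (δ : ℝ) (x : E d) : ℝ := √(‖x‖ ^ 2 + δ ^ 2)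

variable {d : ℕ}

theorem regRadius_pos {δ : ℝ} (hδ : 0 < δ) (x : E d) : 0 < regRadius δ x :=
  Real.sqrt_pos.2 (by positivity)

theorem sq_regRadius (δ : ℝ) (x : E d) : regRadius δ x ^ 2 = ‖x‖ ^ 2 + δ ^ 2 :=
  Real.sq_sqrt (by positivity)

theorem norm_le_regRadius (δ : ℝ) (x : E d) : ‖x‖ ≤ regRadius δ x :=
  Real.le_sqrt_of_sq_le (by nlinarith [sq_nonneg δ])

theorem continuous_regRadius (δ : ℝ) : Continuous (regRadius δ : E d → ℝ) := by
  unfold regRadius; fun_prop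

theorem regRadius_smul {δ : ℝ} (hδ : 0 ≤ δ) (y : E d) :
    regRadius δ (δ • y) = δ * regRadius 1 y := by
  unfold regRadius
  rw [norm_smul, Real.norm_of_nonneg hδ, show (δ * ‖y‖) ^ 2 + δ ^ 2 = δ ^ 2 * (‖y‖ ^ 2 + 1 ^ 2) by
    ring, Real.sqrt_mul (by positivity), Real.sqrt_sq hδ]

theorem tendsto_regRadius (x : E d) : Tendsto (fun δ => regRadius δ x) (𝓝[>] 0) (𝓝 ‖x‖) := by
  have h : Continuous fun δ : ℝ => regRadius δ x := by unfold regRadius; fun_prop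
  have := h.tendsto 0
  simp only [regRadius] at this
  norm_num at this
  exact this.mono_left nhdsWithin_le_nhds

theorem hasLineDerivAt_regRadius {δ : ℝ} (hδ : 0 < δ) (x : E d) (i : Fin d) :
    HasLineDerivAt ℝ (regRadius δ) (x i / regRadius δ x) x (EuclideanSpace.basisFun (Fin d) ℝ i) := by
  set v := EuclideanSpace.basisFun (Fin d) ℝ i
  have h1 : HasFDerivAt (fun x : E d => ‖x‖ ^ 2 + δ ^ 2) (2 • (innerSL ℝ x)) x :=
    (hasStrictFDerivAt_norm_sq x).hasFDerivAt.add_const _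
  have h2 := (h1.sqrt (by positivity)).hasLineDerivAt v
  convert! h2 using 1
  have : inner ℝ x v = x i := by
    rw [real_inner_comm]; simp [v, EuclideanSpace.inner_single_left]
  simp [regRadius, this]
  field_simp

theorem hasLineDerivAt_coord (x : E d) (i : Fin d) :
    HasLineDerivAt ℝ (fun x : E d => ((x i : ℝ) : ℂ)) 1 x (EuclideanSpace.basisFun (Fin d) ℝ i) := by
  let p : E d →L[ℝ] ℝ := EuclideanSpace.proj i
  have h := ((Complex.ofRealCLM.comp p).hasFDerivAt (x := x)).hasLineDerivAt
      (EuclideanSpace.basisFun (Fin d) ℝ i)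
  convert! h using 1
  simp [p]

theorem hasLineDerivAt_comp {F : ℝ → ℂ} {F' : ℂ} {S : E d → ℝ} {S' : ℝ} {x v : E d}
    (hF : HasDerivAt F F' (S x)) (hS : HasLineDerivAt ℝ S S' x v) :
    HasLineDerivAt ℝ (fun x => F (S x)) (S' * F') x v := by
  unfold HasLineDerivAt at *
  have hF' : HasDerivAt F F' (S (x + (0 : ℝ) • v)) := by simpa using hF
  have := hF'.scomp (0 : ℝ) hS
  simpa [Function.comp_def] using this

/-- Integral of `(1 + |y|²)^{-(d+2)/2}` over `ℝ^d`. -/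
theorem integral_regRadius_one (hd : 2 ≤ d) :
    Integrable (fun y : E d => (regRadius 1 y ^ (d + 2))⁻¹) ∧
    ∫ y : E d, (regRadius 1 y ^ (d + 2))⁻¹ = volume.real (Metric.ball (0 : E d) 1) := by
  have : Nontrivial (E d) := by
    apply Module.nontrivial_of_finrank_pos (R := ℝ); simp; omega
  have hint : Integrable (fun y : E d => (regRadius 1 y ^ (d + 2))⁻¹) := by
    have := integrable_rpow_neg_one_add_norm_sq (E := E d) (μ := volume) (r := (d : ℝ) + 2)
      (by simp)
    refine this.congr (Eventually.of_forall fun y => ?_)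
    simp only [regRadius]
    rw [← Real.rpow_natCast _ (d + 2), Real.sqrt_eq_rpow, ← Real.rpow_mul (by positivity),
      ← Real.rpow_neg (by positivity)]
    congr 1
    · ring
    · push_cast; ring
  refine ⟨hint, ?_⟩
  set f : ℝ → ℝ := fun r => (√(r ^ 2 + 1 ^ 2) ^ (d + 2))⁻¹ with hf
  have hint' : IntegrableOn (fun y : ℝ => y ^ (d - 1) • f y) (Ioi 0) := by
    have := (integrable_fun_norm_addHaar (volume : Measure (E d)) (f := f)).1 hint
    simpa using this
  have h := integral_fun_norm_addHaar (volume : Measure (E d)) f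
  -- In polar coordinates the integrand r^{d-1} (1 + r²)^{-(d+2)/2} has the primitive (r/√(1+r²))^d
  -- / d, which goes from 0 to 1/d.
  have key : ∫ y in Ioi (0 : ℝ), y ^ (d - 1) • f y = 1 / d - 0 := by
    have hd0 : (d : ℝ) ≠ 0 := by positivity
    have hder : ∀ x ∈ Ici (0 : ℝ),
        HasDerivAt (fun r : ℝ => (r / √(r ^ 2 + 1 ^ 2)) ^ d / d) (x ^ (d - 1) • f x) x := by
      intro x _
      have hp : 0 < x ^ 2 + 1 ^ 2 := by positivity
      have h1 : HasDerivAt (fun r : ℝ => √(r ^ 2 + 1 ^ 2)) (x / √(x ^ 2 + 1 ^ 2)) x := by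
        have := (((hasDerivAt_id x).pow 2).add_const (1 ^ 2)).sqrt hp.ne'
        convert! this using 1
        simp; field_simp
      have hs : √(x ^ 2 + 1 ^ 2) ≠ 0 := (Real.sqrt_pos.2 hp).ne'
      have h2 := (((hasDerivAt_id x).div h1 hs).pow d).div_const (d : ℝ)
      convert! h2 using 1
      have e : √(x ^ 2 + 1 ^ 2) ^ 2 = x ^ 2 + 1 ^ 2 := Real.sq_sqrt hp.le
      obtain ⟨n, rfl⟩ : ∃ n, d = n + 1 := ⟨d - 1, by omega⟩
      simp only [f, smul_eq_mul, Nat.add_sub_cancel, id, div_pow, Pi.div_apply]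
      set s := √(x ^ 2 + 1 ^ 2)
      have : 1 * s - x * (x / s) = 1 / s := by
        field_simp; rw [e]; ring
      rw [this]
      field_simp
      ring
    have hlim : Tendsto (fun r : ℝ => (r / √(r ^ 2 + 1 ^ 2)) ^ d / d) atTop (𝓝 (1 / d)) := by
      have h0 : Tendsto (fun r : ℝ => (√(1 + (r ^ 2)⁻¹))⁻¹) atTop (𝓝 1) := by
        have h1 : Tendsto (fun r : ℝ => 1 + (r ^ 2)⁻¹) atTop (𝓝 (1 + 0)) :=
          tendsto_const_nhds.add (tendsto_inv_atTop_zero.comp (tendsto_pow_atTop two_ne_zero))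
        have := (h1.sqrt).inv₀ (by simp)
        simpa using this
      have h1 : Tendsto (fun r : ℝ => r / √(r ^ 2 + 1 ^ 2)) atTop (𝓝 1) := by
        refine h0.congr' ?_
        filter_upwards [eventually_gt_atTop 0] with r hr
        rw [show r ^ 2 + 1 ^ 2 = r ^ 2 * (1 + (r ^ 2)⁻¹) by field_simp,
          Real.sqrt_mul (by positivity), Real.sqrt_sq hr.le]
        field_simp
      have := (h1.pow d).div_const (d : ℝ)
      simpa using this
    have := integral_Ioi_of_hasDerivAt_of_tendsto' hder hint' hlim
    rw [this]
    simp; omega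
  simp only [finrank_euclideanSpace, Fintype.card_fin] at h
  rw [key] at h
  refine Eq.trans h ?_
  have hd0 : (d : ℝ) ≠ 0 := by positivity
  simp; field_simp

/-! ### Bounds and local integrability of radial functions singular at the origin. -/

theorem exists_bound_Ioc {f : ℝ → ℂ} (hf : ContinuousOn f (Ioi 0))
    (h0 : f =O[𝓝[>] 0] fun _ => (1 : ℝ)) (M : ℝ) : ∃ C, ∀ r ∈ Ioc 0 M, ‖f r‖ ≤ C := by
  obtain ⟨C, hC⟩ := h0.bound
  obtain ⟨η, hη, hC⟩ := mem_nhdsGT_iff_exists_Ioo_subset.1 hC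
  have hη : (0 : ℝ) < η := hη
  obtain ⟨C', hC'⟩ := (isCompact_Icc (a := η) (b := M)).exists_bound_of_continuousOn
    (hf.mono fun r hr => lt_of_lt_of_le hη hr.1)
  refine ⟨max C C', fun r hr => ?_⟩
  rcases lt_or_ge r η with h | h
  · exact (by simpa using hC ⟨hr.1, h⟩ : ‖f r‖ ≤ C).trans (le_max_left _ _)
  · exact (hC' r ⟨h, hr.2⟩).trans (le_max_right _ _)

theorem aestronglyMeasurable_radial {F : ℝ → ℂ} (hd : 1 ≤ d) (hF : ContinuousOn F (Ioi 0)) :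
    AEStronglyMeasurable (fun x : E d => F ‖x‖) := by
  have : Nontrivial (E d) := by
    apply Module.nontrivial_of_finrank_pos (R := ℝ); simp; omega
  have h : ContinuousOn (fun x : E d => F ‖x‖) {0}ᶜ :=
    hF.comp continuous_norm.continuousOn fun x hx => norm_pos_iff.2 hx
  have := h.aestronglyMeasurable (μ := volume) (measurableSet_singleton 0).compl
  rwa [restrict_compl_singleton] at this

theorem locallyIntegrable_norm_inv (hd : 2 ≤ d) :
    LocallyIntegrable (fun x : E d => ‖x‖⁻¹) := by
  refine locallyIntegrable_of_norm_le_rpow (α := 1) (C := 1) (by simp; omega) (by simp; omega)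
    (Eventually.of_forall fun x => ?_) (by fun_prop)
  simp [Real.rpow_neg_one]

/-- On a compact set F(|x|) is dominated by a multiple of 1/|x|, which is locally integrable once d
≥ 2. -/
theorem locallyIntegrable_radial {F : ℝ → ℂ} (hd : 2 ≤ d) (hF : ContinuousOn F (Ioi 0))
    (hF0 : (fun r : ℝ => r * F r) =O[𝓝[>] 0] fun _ => (1 : ℝ)) :
    LocallyIntegrable (fun x : E d => F ‖x‖) := by
  have : Nontrivial (E d) := by
    apply Module.nontrivial_of_finrank_pos (R := ℝ); simp; omega
  rw [locallyIntegrable_iff]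
  intro K hK
  obtain ⟨R, hR⟩ := hK.isBounded.exists_norm_le
  obtain ⟨C, hC⟩ := exists_bound_Ioc (f := fun r : ℝ => r * F r)
    (Complex.continuous_ofReal.continuousOn.mul hF) hF0 R
  refine Integrable.mono' ((((locallyIntegrable_norm_inv hd).integrableOn_isCompact hK)).const_mul C)
    (aestronglyMeasurable_radial (by omega) hF).restrict ?_
  have h0 : ∀ᵐ x : E d, x ≠ 0 := by
    rw [ae_iff]; simp
  filter_upwards [ae_restrict_mem hK.measurableSet, ae_restrict_of_ae h0] with x hx hx0
  have hp := norm_pos_iff.2 hx0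
  have := hC ‖x‖ ⟨hp, hR x hx⟩
  simp only [norm_mul, Complex.norm_real, norm_norm] at this
  rw [← div_eq_mul_inv, le_div_iff₀ hp]
  linarith

/-- If `F'' + (d-1)/r F' + k² F = 0` for `r > 0` and `r^{d-1} F'(r) → c` as `r → 0`, then
`(Δ + k²) F(|x|) = c |S^{d-1}| δ` on `ℝ^d`. -/
theorem integral_radial_mul_helmholtz (hd : 2 ≤ d) {k c : ℂ} {F F' : ℝ → ℂ}
    (hF : ∀ r, 0 < r → HasDerivAt F (F' r) r)
    (hF' : ∀ r, 0 < r → HasDerivAt F' (-(k ^ 2 * F r) - (d - 1) / r * F' r) r)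
    (hF0 : (fun r : ℝ => r * F r) =O[𝓝[>] 0] fun _ => (1 : ℝ))
    (hF0' : Tendsto (fun r : ℝ => r ^ (d - 1) * F' r) (𝓝[>] 0) (𝓝 c))
    {φ : E d → ℂ} (hφ : ContDiff ℝ ∞ φ) (hφs : HasCompactSupport φ) :
    ∫ x, F ‖x‖ * (Laplacian.laplacian φ x + k ^ 2 * φ x) =
      d * volume.real (Metric.ball (0 : E d) 1) * c * φ 0 := by
  have : Nontrivial (E d) := by
    apply Module.nontrivial_of_finrank_pos (R := ℝ); simp; omega
  have hFc : ContinuousOn F (Ioi 0) := fun r hr => (hF r hr).continuousAt.continuousWithinAt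
  have hFc' : ContinuousOn F' (Ioi 0) := fun r hr => (hF' r hr).continuousAt.continuousWithinAt
  obtain ⟨R, hR⟩ := hφs.isCompact.isBounded.exists_norm_le
  -- For S = √(|x|² + δ²) the classical value of (Δ + k²) F(S) will be δ² S^{-(d+2)} W(S), and W has
  -- the finite limit d·c at 0.
  set W : ℝ → ℂ := fun r => (r : ℂ) ^ d * (k ^ 2 * F r) + d * ((r : ℂ) ^ (d - 1) * F' r) with hW
  have hWc : ContinuousOn W (Ioi 0) := by
    have := Complex.continuous_ofReal.continuousOn (s := Ioi 0)
    fun_prop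
  have hWlim : Tendsto W (𝓝[>] 0) (𝓝 (d * c)) := by
    have h1 : Tendsto (fun r : ℝ => (r : ℂ) ^ (d - 1) * (r * F r)) (𝓝[>] 0) (𝓝 0) := by
      have : (fun r : ℝ => (r : ℂ) ^ (d - 1) * (r * F r)) =O[𝓝[>] 0]
          fun r : ℝ => r ^ (d - 1) * (1 : ℝ) := by
        refine IsBigO.mul (IsBigO.of_bound 1 (Eventually.of_forall fun r => by simp)) hF0
      refine this.trans_tendsto ?_
      have h : Continuous fun r : ℝ => r ^ (d - 1) * (1 : ℝ) := by fun_prop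
      have := (h.tendsto 0).mono_left (nhdsWithin_le_nhds (s := Ioi 0))
      simpa [show d - 1 ≠ 0 by omega] using this
    have := (h1.const_mul (k ^ 2)).add (hF0'.const_mul (d : ℂ))
    simp only [mul_zero, zero_add] at this
    refine this.congr fun r => ?_
    obtain ⟨n, rfl⟩ : ∃ n, d = n + 1 := ⟨d - 1, by omega⟩
    simp only [hW, Nat.add_sub_cancel]
    ring
  set ψ : E d → ℂ := fun x => Laplacian.laplacian φ x + k ^ 2 * φ x with hψ
  have hψc : Continuous ψ := (continuous_laplacian hφ).add (continuous_const.mul hφ.continuous)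
  have hψs : HasCompactSupport ψ := (hasCompactSupport_laplacian hφs).add hφs.mul_left
  obtain ⟨R', hR'⟩ := hψs.isCompact.isBounded.exists_norm_le
  -- the regularized identity
  have hreg : ∀ δ : ℝ, 0 < δ → ∫ x, F (regRadius δ x) * ψ x =
      ∫ y : E d, ((regRadius 1 y ^ (d + 2))⁻¹ : ℝ) * W (δ * regRadius 1 y) * φ (δ • y) := by
    intro δ hδ
    set S : E d → ℝ := regRadius δ with hS
    have hSp : ∀ x, 0 < S x := regRadius_pos hδ
    have hSc : Continuous S := continuous_regRadius δ
    have hSc' : Continuous fun x => (S x : ℂ) := Complex.continuous_ofReal.comp hSc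
    have hS0 : ∀ x, (S x : ℂ) ≠ 0 := fun x => by exact_mod_cast (hSp x).ne'
    have c0 : Continuous fun x => F (S x) := hFc.comp_continuous hSc hSp
    have c1 : Continuous fun x => F' (S x) := hFc'.comp_continuous hSc hSp
    have cx : ∀ i, Continuous fun x : E d => ((x i : ℝ) : ℂ) := fun i =>
      Complex.continuous_ofReal.comp (by fun_prop)
    set f' : Fin d → E d → ℂ := fun i x => F' (S x) / S x * x i with hf'
    -- The second derivative of F(S) is F'/S + (x_i²/S²)(F'' - F'/S); the radial equation turns F''
    -- - F'/S into -k²F - dF'/S.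
    set f'' : Fin d → E d → ℂ := fun i x => F' (S x) / S x
      + (x i) ^ 2 / (S x) ^ 2 * (-(k ^ 2 * F (S x)) - d * F' (S x) / S x) with hf''
    have l1 : ∀ i x, HasLineDerivAt ℝ (fun x => F (S x)) (f' i x) x
        (EuclideanSpace.basisFun (Fin d) ℝ i) := by
      intro i x
      convert! hasLineDerivAt_comp (hF _ (hSp x)) (hasLineDerivAt_regRadius hδ x i) using 1
      simp only [hf', Complex.ofReal_div]
      ring
    have l2 : ∀ i x, HasLineDerivAt ℝ (f' i) (f'' i x) x
        (EuclideanSpace.basisFun (Fin d) ℝ i) := by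
      intro i x
      have hq : HasDerivAt (fun r : ℝ => F' r / r) (((-(k ^ 2 * F (S x)) - (d - 1) / (S x)
          * F' (S x)) * S x - F' (S x) * 1) / (S x : ℂ) ^ 2) (S x) :=
        (hF' _ (hSp x)).div (Complex.ofRealCLM.hasDerivAt (x := S x)) (hS0 x)
      have h1 : HasLineDerivAt ℝ (fun x => F' (S x) / (S x : ℂ)) _ x _ :=
        hasLineDerivAt_comp hq (hasLineDerivAt_regRadius hδ x i)
      have h2 := hasLineDerivAt_coord x i
      unfold HasLineDerivAt at h1 h2 ⊢
      convert! HasDerivAt.mul h1 h2 using 1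
      have : (regRadius δ x : ℂ) ≠ 0 := hS0 x
      simp only [hf'', hS, zero_smul, add_zero, Complex.ofReal_div]
      field_simp
      ring
    have key := integral_mul_laplacian (EuclideanSpace.basisFun (Fin d) ℝ) l1 l2 c0
      (fun i => (c1.div hSc' hS0).mul (cx i))
      (fun i => (c1.div hSc' hS0).add ((((cx i).pow 2).div (hSc'.pow 2)
        fun x => pow_ne_zero 2 (hS0 x)).mul (((continuous_const.mul c0).neg).sub
          ((continuous_const.mul c1).div hSc' hS0)))) hφ hφs
    have i1 : Integrable fun x => F (S x) * Laplacian.laplacian φ x :=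
      (c0.mul (continuous_laplacian hφ)).integrable_of_hasCompactSupport
        (hasCompactSupport_laplacian hφs).mul_left
    have i2 : Integrable fun x => F (S x) * (k ^ 2 * φ x) :=
      (c0.mul (continuous_const.mul hφ.continuous)).integrable_of_hasCompactSupport
        hφs.mul_left.mul_left
    have cs : Continuous fun x => ∑ i, f'' i x := continuous_finsetSum _ fun i _ =>
      (c1.div hSc' hS0).add ((((cx i).pow 2).div (hSc'.pow 2)
        fun x => pow_ne_zero 2 (hS0 x)).mul (((continuous_const.mul c0).neg).sub
          ((continuous_const.mul c1).div hSc' hS0)))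
    have i3 : Integrable fun x => (∑ i, f'' i x) * φ x :=
      (cs.mul hφ.continuous).integrable_of_hasCompactSupport hφs.mul_left
    have step1 : ∫ x, F (S x) * ψ x =
        ∫ x, ((δ ^ 2 * (S x ^ (d + 2))⁻¹ : ℝ) : ℂ) * W (S x) * φ x := by
      simp only [hψ, mul_add]
      rw [integral_add i1 i2, key, ← integral_add i3 i2]
      refine integral_congr_ae (Eventually.of_forall fun x => ?_)
      have hsum : (∑ i, ((x i : ℝ) : ℂ) ^ 2) = (S x : ℂ) ^ 2 - (δ : ℂ) ^ 2 := by
        have h := sq_regRadius δ x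
        rw [EuclideanSpace.norm_sq_eq] at h
        simp only [Real.norm_eq_abs, sq_abs] at h
        have : ∑ i, x i ^ 2 = S x ^ 2 - δ ^ 2 := by rw [hS]; linarith
        exact_mod_cast congrArg (Complex.ofReal) this
      have hsum' : ∑ i, f'' i x = -(k ^ 2 * F (S x))
          + (δ : ℂ) ^ 2 / (S x) ^ 2 * (k ^ 2 * F (S x) + d * F' (S x) / S x) := by
        simp only [hf'', Finset.sum_add_distrib, ← Finset.sum_mul, ← Finset.sum_div, hsum]
        have := hS0 x
        simp
        field_simp
        ring
      simp only [hsum', hW]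
      have := hS0 x
      obtain ⟨n, hn⟩ : ∃ n, d = n + 1 := ⟨d - 1, by omega⟩
      have e1 : (S x : ℂ) ^ d = S x ^ (d - 1) * S x := by
        rw [hn, Nat.add_sub_cancel, pow_succ]
      have e2 : (S x : ℂ) ^ (d + 2) = S x ^ (d - 1) * S x ^ 3 := by
        rw [hn, Nat.add_sub_cancel]; ring
      push_cast
      rw [e1, e2]
      field_simp
      ring
    rw [step1]
    -- Under x = δy the Jacobian δ^d times δ² S^{-(d+2)} becomes (1 + |y|²)^{-(d+2)/2}, free of δ.
    have sc := Measure.integral_comp_smul_of_nonneg (μ := (volume : Measure (E d)))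
      (fun x => ((δ ^ 2 * (S x ^ (d + 2))⁻¹ : ℝ) : ℂ) * W (S x) * φ x) δ (hR := hδ.le)
    have hδd : δ ^ d ≠ 0 := by positivity
    simp only [finrank_euclideanSpace, Fintype.card_fin] at sc
    rw [eq_inv_smul_iff₀ hδd, ← integral_smul] at sc
    rw [← sc]
    refine integral_congr_ae (Eventually.of_forall fun y => ?_)
    simp only [hS, regRadius_smul hδ.le, Complex.real_smul, Complex.ofReal_mul]
    rw [← mul_assoc, ← mul_assoc]
    congr 2
    have : regRadius 1 y ≠ 0 := (regRadius_pos one_pos y).ne'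
    norm_cast
    field_simp
    ring
  -- the limit of the left-hand side
  have hnull : ∀ᵐ x : E d, x ≠ 0 := by
    rw [ae_iff]; simp
  have hL : Tendsto (fun δ : ℝ => ∫ x, F (regRadius δ x) * ψ x) (𝓝[>] 0)
      (𝓝 (∫ x, F ‖x‖ * ψ x)) := by
    -- On the support with δ < 1 one has S² ≤ R'² + 1, and 2S ≤ S² + 1, so R'² + 2 is a crude bound
    -- for S that avoids square roots.
    obtain ⟨C, hC⟩ := exists_bound_Ioc (f := fun r : ℝ => r * F r)
      (Complex.continuous_ofReal.continuousOn.mul hFc) hF0 (R' ^ 2 + 2)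
    have hev : ∀ᶠ δ : ℝ in 𝓝[>] 0, 0 < δ ∧ δ < 1 := by
      filter_upwards [Ioo_mem_nhdsGT (zero_lt_one' ℝ)] with δ h using h
    have hC0 : ∀ x : E d, x ≠ 0 → x ∈ tsupport ψ → ∀ δ, 0 < δ → δ < 1 →
        ‖F (regRadius δ x)‖ ≤ C * ‖x‖⁻¹ := by
      intro x hx hxs δ hδ hδ1
      have hp := regRadius_pos hδ x
      have hxp := norm_pos_iff.2 hx
      have hS : regRadius δ x ≤ R' ^ 2 + 2 := by
        have h1 := sq_regRadius δ x
        have h2 := hR' x hxs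
        nlinarith [sq_nonneg (regRadius δ x - 1)]
      have := hC _ ⟨hp, hS⟩
      simp only [norm_mul, Complex.norm_real, Real.norm_of_nonneg hp.le] at this
      rw [← div_eq_mul_inv, le_div_iff₀ hxp]
      have := mul_le_mul_of_nonneg_right (norm_le_regRadius δ x) (norm_nonneg (F (regRadius δ x)))
      linarith
    refine tendsto_integral_filter_of_dominated_convergence
      (fun x => ‖x‖⁻¹ • (C * ‖ψ x‖)) ?_ ?_ ?_ ?_
    · filter_upwards [hev] with δ hδ
      exact ((hFc.comp_continuous (continuous_regRadius δ) (regRadius_pos hδ.1)).mul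
        hψc).aestronglyMeasurable
    · filter_upwards [hev] with δ hδ
      filter_upwards [hnull] with x hx
      by_cases hxs : x ∈ tsupport ψ
      · rw [norm_mul, smul_eq_mul]
        have := mul_le_mul_of_nonneg_right (hC0 x hx hxs δ hδ.1 hδ.2) (norm_nonneg (ψ x))
        linarith
      · simp [image_eq_zero_of_notMem_tsupport hxs]
    · exact (locallyIntegrable_norm_inv hd).integrable_smul_right_of_hasCompactSupport
        (continuous_const.mul hψc.norm) (hψs.norm.mul_left)
    · filter_upwards [hnull] with x hx
      exact ((hFc.continuousAt (Ioi_mem_nhds (norm_pos_iff.2 hx))).tendsto.comp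
        (tendsto_regRadius x)).mul_const _
  -- the limit of the right-hand side
  have hRlim : Tendsto (fun δ : ℝ => ∫ y : E d,
      ((regRadius 1 y ^ (d + 2))⁻¹ : ℝ) * W (δ * regRadius 1 y) * φ (δ • y)) (𝓝[>] 0)
      (𝓝 (∫ y : E d, ((regRadius 1 y ^ (d + 2))⁻¹ : ℝ) * (d * c) * φ 0)) := by
    obtain ⟨C, hC⟩ := exists_bound_Ioc hWc (hWlim.isBigO_one ℝ) (R ^ 2 + 2)
    obtain ⟨C', hC'⟩ := hφ.continuous.bounded_above_of_compact_support hφs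
    have hev : ∀ᶠ δ : ℝ in 𝓝[>] 0, 0 < δ ∧ δ < 1 := by
      filter_upwards [Ioo_mem_nhdsGT (zero_lt_one' ℝ)] with δ h using h
    refine tendsto_integral_filter_of_dominated_convergence
      (fun y => (regRadius 1 y ^ (d + 2))⁻¹ * (|C| * |C'|)) ?_ ?_ ?_ ?_
    · filter_upwards [hev] with δ hδ
      refine Continuous.aestronglyMeasurable ?_
      refine ((Complex.continuous_ofReal.comp (((continuous_regRadius 1).pow _).inv₀ fun y =>
        pow_ne_zero _ (regRadius_pos one_pos y).ne')).mul
          (hWc.comp_continuous (continuous_const.mul (continuous_regRadius 1)) fun y =>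
            mul_pos hδ.1 (regRadius_pos one_pos y))).mul
              (hφ.continuous.comp (continuous_const_smul δ))
    · filter_upwards [hev] with δ hδ
      refine Eventually.of_forall fun y => ?_
      have hp := regRadius_pos one_pos y
      by_cases hys : δ • y ∈ tsupport φ
      · have hS : δ * regRadius 1 y ≤ R ^ 2 + 2 := by
          rw [← regRadius_smul hδ.1.le]
          have h1 := sq_regRadius δ (δ • y)
          have h2 := hR _ hys
          nlinarith [sq_nonneg (regRadius δ (δ • y) - 1), norm_nonneg (δ • y)]
        have h1 := (hC _ ⟨mul_pos hδ.1 hp, hS⟩).trans (le_abs_self C)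
        have h2 := (hC' (δ • y)).trans (le_abs_self C')
        rw [norm_mul, norm_mul, Complex.norm_real, Real.norm_of_nonneg (by positivity), mul_assoc]
        gcongr
      · rw [image_eq_zero_of_notMem_tsupport hys]
        simp only [mul_zero, norm_zero]
        positivity
    · exact (integral_regRadius_one hd).1.mul_const _
    · refine Eventually.of_forall fun y => ?_
      have hp := regRadius_pos one_pos y
      have h1 : Tendsto (fun δ : ℝ => δ * regRadius 1 y) (𝓝[>] 0) (𝓝[>] 0) := by
        refine tendsto_nhdsWithin_iff.2 ⟨?_, ?_⟩
        · have : Continuous fun δ : ℝ => δ * regRadius 1 y := by fun_prop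
          have := this.tendsto 0
          rw [zero_mul] at this
          exact this.mono_left nhdsWithin_le_nhds
        · filter_upwards [self_mem_nhdsWithin] with δ hδ using mul_pos hδ hp
      have h2 : Tendsto (fun δ : ℝ => φ (δ • y)) (𝓝[>] 0) (𝓝 (φ 0)) := by
        have : Continuous fun δ : ℝ => φ (δ • y) := hφ.continuous.comp (by fun_prop)
        have := this.tendsto 0
        rw [zero_smul] at this
        exact this.mono_left nhdsWithin_le_nhds
      exact ((hWlim.comp h1).const_mul _).mul h2
  have hval := tendsto_nhds_unique hL (hRlim.congr' (by
    filter_upwards [self_mem_nhdsWithin] with δ hδ using (hreg δ hδ).symm))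
  rw [hval]
  simp only [mul_assoc]
  rw [integral_mul_const, integral_complex_ofReal, (integral_regRadius_one hd).2]
  ring

/-! ### Power series with factorially decaying coefficients -/

/-- The sum `∑ aₙ wⁿ`. -/
noncomputable def seriesSum (a : ℕ → ℂ) (w : ℂ) : ℂ := ∑' n, a n * w ^ n

/-- The coefficients of the derived power series. -/
def derivCoeff (a : ℕ → ℂ) (n : ℕ) : ℂ := (n + 1) * a (n + 1)

/-- The coefficients are `O(1 / n!)`, with constant `1`. -/
def FactorialDecay (a : ℕ → ℂ) : Prop := ∀ n, ‖a n‖ ≤ 1 / (n.factorial : ℝ)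

/-- The factor n + 1 cancels against (n+1)!, so the constant 1 survives and the class is closed
under differentiation. -/
theorem FactorialDecay.derivCoeff {a : ℕ → ℂ} (ha : FactorialDecay a) :
    FactorialDecay (derivCoeff a) := by
  intro n
  have h := ha (n + 1)
  have e : ‖((n : ℂ) + 1)‖ = (n : ℝ) + 1 := by
    rw [← Nat.cast_succ, Complex.norm_natCast]; simp
  rw [MorseIngard.derivCoeff, norm_mul, e]
  calc ((n : ℝ) + 1) * ‖a (n + 1)‖ ≤ (n + 1) * (1 / ((n + 1).factorial : ℝ)) := by gcongr
    _ = 1 / (n.factorial : ℝ) := by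
      rw [Nat.factorial_succ]; push_cast; field_simp

theorem FactorialDecay.summable {a : ℕ → ℂ} (ha : FactorialDecay a) (w : ℂ) :
    Summable fun n => a n * w ^ n := by
  refine Summable.of_norm_bounded (Real.summable_pow_div_factorial ‖w‖) fun n => ?_
  rw [norm_mul, norm_pow, div_eq_mul_one_div, mul_comm]
  exact mul_le_mul_of_nonneg_left (ha n) (by positivity)

theorem seriesSum_zero (a : ℕ → ℂ) : seriesSum a 0 = a 0 := by
  rw [seriesSum, tsum_eq_single 0]
  · simp
  · intro n hn; simp [hn]

theorem FactorialDecay.hasDerivAt {a : ℕ → ℂ} (ha : FactorialDecay a) (w : ℂ) :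
    HasDerivAt (seriesSum a) (seriesSum (MorseIngard.derivCoeff a) w) w := by
  set R := ‖w‖ + 1
  set u : ℕ → ℝ := fun n => 1 / (n.factorial : ℝ) * (n * R ^ (n - 1)) with hu
  have hus : Summable u := by
    rw [← summable_nat_add_iff 1]
    refine (Real.summable_pow_div_factorial R).congr fun n => ?_
    simp only [hu, Nat.factorial_succ, Nat.add_sub_cancel]
    push_cast
    field_simp
  have hbound : ∀ n, ∀ y ∈ Metric.ball (0 : ℂ) R, ‖a n * (n * y ^ (n - 1))‖ ≤ u n := by
    intro n y hy
    rw [mem_ball_zero_iff] at hy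
    rw [norm_mul, norm_mul, norm_pow, Complex.norm_natCast]
    have := ha n
    simp only [hu]
    gcongr
  have hw : w ∈ Metric.ball (0 : ℂ) R := by rw [mem_ball_zero_iff]; simp [R]
  have h := hasDerivAt_tsum_of_isPreconnected (g := fun n y => a n * y ^ n)
    (g' := fun n y => a n * (n * y ^ (n - 1))) hus Metric.isOpen_ball
    (convex_ball (0 : ℂ) R).isPreconnected (fun n y _ => (hasDerivAt_pow n y).const_mul _)
    hbound hw (ha.summable w) hw
  have e : seriesSum (MorseIngard.derivCoeff a) w = ∑' n, a n * (n * w ^ (n - 1)) := by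
    rw [Summable.tsum_eq_zero_add (Summable.of_norm_bounded hus fun n => hbound n w hw)]
    simp only [seriesSum, MorseIngard.derivCoeff, Nat.add_sub_cancel]
    simp
    refine tsum_congr fun n => ?_
    ring
  rw [e]
  exact h

/-- In the variable w = z²/4 the Bessel operator f'' + f'/z becomes w g'' + g', which acts on
coefficients as the weighted shift a_n ↦ (n+1)² a_{n+1}. -/
theorem FactorialDecay.mul_seriesSum_derivCoeff {a : ℕ → ℂ} (ha : FactorialDecay a) (w : ℂ) :
    w * seriesSum (MorseIngard.derivCoeff (MorseIngard.derivCoeff a)) w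
      + seriesSum (MorseIngard.derivCoeff a) w = seriesSum (fun n => (n + 1) ^ 2 * a (n + 1)) w := by
  have hs1 := ha.derivCoeff.derivCoeff.summable w
  have hs2 := ha.derivCoeff.summable w
  have hs3 : Summable fun n : ℕ => (n * MorseIngard.derivCoeff a n) * w ^ n := by
    rw [← summable_nat_add_iff 1]
    refine (hs1.mul_left w).congr fun n => ?_
    simp only [MorseIngard.derivCoeff]; push_cast; ring
  have e : w * seriesSum (MorseIngard.derivCoeff (MorseIngard.derivCoeff a)) w
      = ∑' n : ℕ, (n * MorseIngard.derivCoeff a n) * w ^ n := by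
    rw [hs3.tsum_eq_zero_add, seriesSum, ← tsum_mul_left]
    simp only [Nat.cast_zero, zero_mul, zero_add]
    refine tsum_congr fun n => ?_
    simp only [MorseIngard.derivCoeff]; push_cast; ring
  rw [e, seriesSum, ← hs3.tsum_add hs2, seriesSum]
  refine tsum_congr fun n => ?_
  simp only [MorseIngard.derivCoeff]; ring

/-! ### The series of `J₀` and `Y₀` -/

/-- Coefficients of `J₀` as a power series in `z² / 4`. -/
noncomputable def coeffJ (n : ℕ) : ℂ := (-1) ^ n / (n.factorial : ℂ) ^ 2

/-- Coefficients of the analytic part of `Y₀` as a power series in `z² / 4`. -/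
noncomputable def coeffY (n : ℕ) : ℂ := (-1) ^ n * ((harmonic n : ℚ) : ℂ) / (n.factorial : ℂ) ^ 2

theorem factorialDecay_coeffJ : FactorialDecay coeffJ := by
  intro n
  have h1 : (1 : ℝ) ≤ n.factorial := by exact_mod_cast n.factorial_pos
  simp only [coeffJ, norm_div, norm_pow, norm_neg, norm_one, one_pow, Complex.norm_natCast]
  gcongr
  nlinarith

theorem harmonic_le_self (n : ℕ) : harmonic n ≤ n := by
  induction n with
  | zero => simp
  | succ n ih =>
    rw [harmonic_succ]
    have : ((n + 1 : ℕ) : ℚ)⁻¹ ≤ 1 := inv_le_one_of_one_le₀ (by simp)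
    push_cast at this ⊢
    linarith

theorem factorialDecay_coeffY : FactorialDecay coeffY := by
  intro n
  have h1 : (0 : ℝ) < n.factorial := by exact_mod_cast n.factorial_pos
  have h2 : ‖((harmonic n : ℚ) : ℂ)‖ ≤ n.factorial := by
    have h0 : 0 ≤ harmonic n := Finset.sum_nonneg fun i _ => by positivity
    have h3 : harmonic n ≤ n.factorial :=
      (harmonic_le_self n).trans (by exact_mod_cast n.self_le_factorial)
    rw [← Complex.ofReal_ratCast, Complex.norm_real, Real.norm_of_nonneg (by exact_mod_cast h0)]
    exact_mod_cast h3
  simp only [coeffY, norm_div, norm_mul, norm_pow, norm_neg, norm_one, one_pow,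
    Complex.norm_natCast, one_mul]
  rw [div_le_div_iff₀ (by positivity) h1]
  nlinarith

/-- The weighted shift sends the coefficients of J₀ to their negatives. -/
theorem seriesSum_coeffJ_ode (w : ℂ) :
    w * seriesSum (derivCoeff (derivCoeff coeffJ)) w + seriesSum (derivCoeff coeffJ) w
      + seriesSum coeffJ w = 0 := by
  rw [factorialDecay_coeffJ.mul_seriesSum_derivCoeff, seriesSum, seriesSum, ← eq_neg_iff_add_eq_zero,
    ← tsum_neg]
  refine tsum_congr fun n => ?_
  have : (n.factorial : ℂ) ≠ 0 := by exact_mod_cast n.factorial_ne_zero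
  have : (n : ℂ) + 1 ≠ 0 := by exact_mod_cast n.succ_ne_zero
  simp only [coeffJ, Nat.factorial_succ]
  push_cast
  field_simp
  ring

/-- The increment 1/(n+1) of the harmonic numbers leaves a source term, the derived J₀ series. It is
what the cross term of log · J₀ needs in order to cancel. -/
theorem seriesSum_coeffY_ode (w : ℂ) :
    w * seriesSum (derivCoeff (derivCoeff coeffY)) w + seriesSum (derivCoeff coeffY) w
      + seriesSum coeffY w = seriesSum (derivCoeff coeffJ) w := by
  rw [factorialDecay_coeffY.mul_seriesSum_derivCoeff, ← eq_sub_iff_add_eq, seriesSum, seriesSum,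
    seriesSum, ← (factorialDecay_coeffJ.derivCoeff.summable w).tsum_sub
      (factorialDecay_coeffY.summable w)]
  refine tsum_congr fun n => ?_
  have : (n.factorial : ℂ) ≠ 0 := by exact_mod_cast n.factorial_ne_zero
  have : (n : ℂ) + 1 ≠ 0 := by exact_mod_cast n.succ_ne_zero
  simp only [coeffY, coeffJ, derivCoeff, Nat.factorial_succ, harmonic_succ]
  push_cast
  field_simp
  ring

/-! ### `J₀` and `H₀⁽¹⁾` and their derivatives -/

theorem besselJ0_eq (z : ℂ) : besselJ0 z = seriesSum coeffJ (z ^ 2 / 4) := by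
  refine tsum_congr fun n => ?_
  simp only [coeffJ]; ring

/-- The derivative of `J₀`. -/
noncomputable def besselJ0Deriv (z : ℂ) : ℂ := seriesSum (derivCoeff coeffJ) (z ^ 2 / 4) * (z / 2)

/-- The factor `1 + (2i/π)(log (z/2) + γ)` of `J₀` in `H₀⁽¹⁾`. -/
noncomputable def hankelLog (z : ℂ) : ℂ :=
  1 + 2 * Complex.I / Real.pi * (Complex.log (z / 2) + Real.eulerMascheroniConstant)

theorem hankelH0_eq (z : ℂ) : hankelH0 z = hankelLog z * seriesSum coeffJ (z ^ 2 / 4)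
    - 2 * Complex.I / Real.pi * seriesSum coeffY (z ^ 2 / 4) := by
  have : ∑' n : ℕ, (-1) ^ n * ((harmonic n : ℚ) : ℂ) * (z ^ 2 / 4) ^ n / ((n.factorial : ℂ) ^ 2)
      = seriesSum coeffY (z ^ 2 / 4) := by
    refine tsum_congr fun n => ?_
    simp only [coeffY]; ring
  rw [hankelH0, besselY0, this, besselJ0_eq, hankelLog]
  ring

/-- The derivative of `H₀⁽¹⁾`. -/
noncomputable def hankelH0Deriv (z : ℂ) : ℂ :=
  2 * Complex.I / Real.pi / z * seriesSum coeffJ (z ^ 2 / 4)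
    + hankelLog z * (seriesSum (derivCoeff coeffJ) (z ^ 2 / 4) * (z / 2))
    - 2 * Complex.I / Real.pi * (seriesSum (derivCoeff coeffY) (z ^ 2 / 4) * (z / 2))

theorem FactorialDecay.hasDerivAt_comp_sq {a : ℕ → ℂ} (ha : FactorialDecay a) (z : ℂ) :
    HasDerivAt (fun z => seriesSum a (z ^ 2 / 4))
      (seriesSum (MorseIngard.derivCoeff a) (z ^ 2 / 4) * (z / 2)) z := by
  have h := (((hasDerivAt_id z).pow 2).div_const 4)
  have := (ha.hasDerivAt (z ^ 2 / 4)).comp z (h := fun z => z ^ 2 / 4) h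
  convert! this using 1
  simp; left; ring

theorem hasDerivAt_besselJ0 (z : ℂ) : HasDerivAt besselJ0 (besselJ0Deriv z) z := by
  rw [show besselJ0 = fun z => seriesSum coeffJ (z ^ 2 / 4) from funext besselJ0_eq]
  exact factorialDecay_coeffJ.hasDerivAt_comp_sq z

theorem hasDerivAt_besselJ0Deriv {z : ℂ} (hz : z ≠ 0) :
    HasDerivAt besselJ0Deriv (-(besselJ0Deriv z / z) - besselJ0 z) z := by
  have h := (factorialDecay_coeffJ.derivCoeff.hasDerivAt_comp_sq z).mul
    ((hasDerivAt_id z).div_const 2)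
  convert! h using 1
  have e := seriesSum_coeffJ_ode (z ^ 2 / 4)
  simp only [besselJ0Deriv, besselJ0_eq, id]
  field_simp
  linear_combination (-4) * e

theorem mem_slitPlane_of_im_pos {z : ℂ} (hz : 0 < z.im) : z ∈ Complex.slitPlane :=
  Complex.mem_slitPlane_iff.2 (Or.inr hz.ne')

theorem ne_zero_of_im_pos {z : ℂ} (hz : 0 < z.im) : z ≠ 0 := by
  rintro rfl; simp at hz

theorem hasDerivAt_hankelLog {z : ℂ} (hz : 0 < z.im) :
    HasDerivAt hankelLog (2 * Complex.I / Real.pi / z) z := by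
  have h1 : HasDerivAt (fun z : ℂ => z / 2) (1 / 2) z := (hasDerivAt_id z).div_const 2
  have h2 : z / 2 ∈ Complex.slitPlane := by
    apply mem_slitPlane_of_im_pos
    simpa using hz
  have h3 := (((h1.clog h2).add_const (Real.eulerMascheroniConstant : ℂ)).const_mul
    (2 * Complex.I / Real.pi)).const_add 1
  convert! h3 using 1
  have := ne_zero_of_im_pos hz
  field_simp

theorem hasDerivAt_hankelH0 {z : ℂ} (hz : 0 < z.im) :
    HasDerivAt hankelH0 (hankelH0Deriv z) z := by
  rw [show hankelH0 = _ from funext hankelH0_eq]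
  exact ((hasDerivAt_hankelLog hz).mul (factorialDecay_coeffJ.hasDerivAt_comp_sq z)).sub
    ((factorialDecay_coeffY.hasDerivAt_comp_sq z).const_mul _)

/-- The logarithmic factor L has L' = c/z with c = 2i/π, so L'' + L'/z = 0 and L·J₀ contributes only
the cross term 2(c/z)J₀', which equals c times the source in `seriesSum_coeffY_ode`. -/
theorem hasDerivAt_hankelH0Deriv {z : ℂ} (hz : 0 < z.im) :
    HasDerivAt hankelH0Deriv (-(hankelH0Deriv z / z) - hankelH0 z) z := by
  have hz0 := ne_zero_of_im_pos hz
  have hh : HasDerivAt (fun z : ℂ => z / 2) (1 / 2) z := (hasDerivAt_id z).div_const 2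
  have h1 := ((hasDerivAt_const z (2 * Complex.I / Real.pi : ℂ)).div (hasDerivAt_id z) hz0).mul
    (factorialDecay_coeffJ.hasDerivAt_comp_sq z)
  have h2 := (hasDerivAt_hankelLog hz).mul
    ((factorialDecay_coeffJ.derivCoeff.hasDerivAt_comp_sq z).mul hh)
  have h3 := ((factorialDecay_coeffY.derivCoeff.hasDerivAt_comp_sq z).mul hh).const_mul
    (2 * Complex.I / Real.pi : ℂ)
  convert! (h1.add h2).sub h3 using 1
  have eJ := seriesSum_coeffJ_ode (z ^ 2 / 4)
  have eY := seriesSum_coeffY_ode (z ^ 2 / 4)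
  have hpi : (Real.pi : ℂ) ≠ 0 := by exact_mod_cast Real.pi_ne_zero
  simp only [hankelH0Deriv, hankelH0_eq, id, Pi.mul_apply, Pi.div_apply]
  generalize (2 * Complex.I / Real.pi : ℂ) = c
  field_simp
  linear_combination (-4) * z ^ 2 * hankelLog z * eJ + 4 * z ^ 2 * c * eY

/-! ### Behaviour of `J₀` and `H₀⁽¹⁾` at the origin -/

/-- The open upper half plane. -/
def upperHalf : Set ℂ := {z | 0 < z.im}

theorem isOpen_upperHalf : IsOpen upperHalf := isOpen_lt continuous_const Complex.continuous_im

theorem convex_upperHalf : Convex ℝ upperHalf := convex_halfSpace_im_gt 0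

theorem tendsto_id_upperHalf : Tendsto (fun z : ℂ => z) (𝓝[upperHalf] 0) (𝓝 0) :=
  nhdsWithin_le_nhds

theorem tendsto_mul_log : Tendsto (fun z : ℂ => z * Complex.log z) (𝓝[≠] 0) (𝓝 0) := by
  have h1 : Tendsto (fun z : ℂ => |Real.log ‖z‖ * ‖z‖| + ‖z‖ * Real.pi) (𝓝[≠] 0) (𝓝 0) := by
    have hn : Tendsto (fun z : ℂ => ‖z‖) (𝓝[≠] 0) (𝓝[>] 0) := tendsto_norm_nhdsNE_zero
    have h2 := (tendsto_log_mul_rpow_nhdsGT_zero zero_lt_one).comp hn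
    have h3 : Tendsto (fun z : ℂ => ‖z‖) (𝓝[≠] 0) (𝓝 0) := hn.mono_right nhdsWithin_le_nhds
    have := h2.abs.add (h3.mul_const Real.pi)
    simpa [Function.comp_def] using this
  refine squeeze_zero_norm (fun z => ?_) h1
  have h : ‖Complex.log z‖ ≤ |Real.log ‖z‖| + Real.pi := by
    have := Complex.norm_le_abs_re_add_abs_im (Complex.log z)
    rw [Complex.log_re, Complex.log_im] at this
    linarith [Complex.abs_arg_le_pi z]
  rw [norm_mul, abs_mul, abs_norm]
  nlinarith [norm_nonneg z]

theorem tendsto_mul_hankelLog : Tendsto (fun z : ℂ => z * hankelLog z) (𝓝[upperHalf] 0) (𝓝 0) := by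
  have h1 : Tendsto (fun z : ℂ => z / 2) (𝓝[upperHalf] 0) (𝓝[≠] 0) := by
    refine tendsto_nhdsWithin_iff.2 ⟨?_, ?_⟩
    · simpa using tendsto_id_upperHalf.div_const 2
    · filter_upwards [self_mem_nhdsWithin] with z hz
      have := ne_zero_of_im_pos hz
      simp [this]
  have h2 := ((tendsto_mul_log.comp h1).const_mul (2 * (2 * Complex.I / Real.pi))).add
    (tendsto_id_upperHalf.mul_const (1 + 2 * Complex.I / Real.pi * Real.eulerMascheroniConstant))
  simp only [mul_zero, zero_mul, add_zero] at h2
  refine h2.congr fun z => ?_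
  simp only [Function.comp, hankelLog]
  ring

theorem FactorialDecay.tendsto_comp_sq {a : ℕ → ℂ} (ha : FactorialDecay a) :
    Tendsto (fun z : ℂ => seriesSum a (z ^ 2 / 4)) (𝓝[upperHalf] 0) (𝓝 (a 0)) := by
  have h := (ha.hasDerivAt_comp_sq 0).continuousAt.tendsto
  simp only [ne_eq, OfNat.ofNat_ne_zero, not_false_eq_true, zero_pow, zero_div,
    seriesSum_zero] at h
  exact h.mono_left nhdsWithin_le_nhds

theorem coeffJ_zero : coeffJ 0 = 1 := by simp [coeffJ]

theorem coeffY_zero : coeffY 0 = 0 := by simp [coeffY]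

theorem tendsto_besselJ0 : Tendsto besselJ0 (𝓝[upperHalf] 0) (𝓝 1) := by
  rw [show besselJ0 = _ from funext besselJ0_eq, ← coeffJ_zero]
  exact factorialDecay_coeffJ.tendsto_comp_sq

theorem tendsto_besselJ0Deriv : Tendsto besselJ0Deriv (𝓝[upperHalf] 0) (𝓝 0) := by
  have := factorialDecay_coeffJ.derivCoeff.tendsto_comp_sq.mul
    (tendsto_id_upperHalf.div_const 2)
  rw [zero_div, mul_zero] at this
  exact this

theorem tendsto_mul_hankelH0 : Tendsto (fun z => z * hankelH0 z) (𝓝[upperHalf] 0) (𝓝 0) := by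
  have h1 := tendsto_mul_hankelLog.mul factorialDecay_coeffJ.tendsto_comp_sq
  have h2 := (tendsto_id_upperHalf.mul factorialDecay_coeffY.tendsto_comp_sq).const_mul
    (2 * Complex.I / Real.pi)
  have := h1.sub h2
  simp only [zero_mul, mul_zero, sub_zero] at this
  refine this.congr fun z => ?_
  rw [hankelH0_eq]; ring

theorem tendsto_mul_hankelH0Deriv :
    Tendsto (fun z => z * hankelH0Deriv z) (𝓝[upperHalf] 0) (𝓝 (2 * Complex.I / Real.pi)) := by
  have h1 := factorialDecay_coeffJ.tendsto_comp_sq.const_mul (2 * Complex.I / Real.pi)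
  have h2 := tendsto_mul_hankelLog.mul ((factorialDecay_coeffJ.derivCoeff.tendsto_comp_sq).mul
    (tendsto_id_upperHalf.div_const 2))
  have h3 := (tendsto_id_upperHalf.mul ((factorialDecay_coeffY.derivCoeff.tendsto_comp_sq).mul
    (tendsto_id_upperHalf.div_const 2))).const_mul (2 * Complex.I / Real.pi)
  have := (h1.add h2).sub h3
  simp only [zero_mul, mul_zero, sub_zero, add_zero, coeffJ_zero, mul_one] at this
  refine this.congr' ?_
  filter_upwards [self_mem_nhdsWithin] with z hz
  have := ne_zero_of_im_pos hz
  rw [hankelH0Deriv]; field_simp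

/-- J₀ - 1 is o(z) because J₀'(0) = 0, and z times the logarithmic factor tends to 0, so the factor
J₀ may be replaced by 1 in the singular part. -/
theorem tendsto_hankelH0_sub_log :
    Tendsto (fun z => hankelH0 z - hankelLog z) (𝓝[upperHalf] 0) (𝓝 0) := by
  have hO : Tendsto (fun z : ℂ => (seriesSum coeffJ (z ^ 2 / 4) - 1) / z) (𝓝[upperHalf] 0)
      (𝓝 0) := by
    have h := (factorialDecay_coeffJ.hasDerivAt_comp_sq 0).tendsto_slope
    have hsub : upperHalf ⊆ {0}ᶜ := fun z hz => ne_zero_of_im_pos hz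
    have := h.mono_left (nhdsWithin_mono 0 hsub)
    simp only [zero_div, mul_zero] at this
    refine this.congr fun z => ?_
    simp [slope_def_field, seriesSum_zero, coeffJ_zero]
  have h2 := factorialDecay_coeffY.tendsto_comp_sq.const_mul (2 * Complex.I / Real.pi)
  have := (tendsto_mul_hankelLog.mul hO).sub h2
  simp only [coeffY_zero, mul_zero, sub_zero] at this
  refine this.congr' ?_
  filter_upwards [self_mem_nhdsWithin] with z hz
  have := ne_zero_of_im_pos hz
  rw [hankelH0_eq]; field_simp; ring

/-! ### Wronskians of the Bessel equation -/

/-- Abel's identity: z times the Wronskian has derivative zero on the connected upper half plane.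
Its value can be read off along any filter living there, in particular at the origin. -/
theorem wronskian_const {f f' g g' : ℂ → ℂ}
    (hf : ∀ z ∈ upperHalf, HasDerivAt f (f' z) z)
    (hf' : ∀ z ∈ upperHalf, HasDerivAt f' (-(f' z / z) - f z) z)
    (hg : ∀ z ∈ upperHalf, HasDerivAt g (g' z) z)
    (hg' : ∀ z ∈ upperHalf, HasDerivAt g' (-(g' z / z) - g z) z) {l : Filter ℂ} [l.NeBot]
    (hl : ∀ᶠ z in l, z ∈ upperHalf) {c : ℂ}
    (hlim : Tendsto (fun z => z * (f z * g' z - f' z * g z)) l (𝓝 c)) :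
    ∀ z ∈ upperHalf, z * (f z * g' z - f' z * g z) = c := by
  have hd : ∀ z ∈ upperHalf, HasDerivAt (fun z => z * (f z * g' z - f' z * g z)) 0 z := by
    intro z hz
    convert! (hasDerivAt_id z).mul (((hf z hz).mul (hg' z hz)).sub ((hf' z hz).mul (hg z hz)))
      using 1
    have := ne_zero_of_im_pos hz
    simp
    field_simp
    ring
  intro z hz
  refine tendsto_nhds_unique (Filter.Tendsto.congr' ?_ tendsto_const_nhds) hlim
  filter_upwards [hl] with w hw
  exact isOpen_upperHalf.is_const_of_deriv_eq_zero convex_upperHalf.isPreconnected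
    (fun z hz => (hd z hz).differentiableAt.differentiableWithinAt)
    (fun z hz => (hd z hz).deriv) hz hw

/-- A solution of the Bessel equation that tends to `0` along some approach to the origin, together
with `z f'(z)`, vanishes. -/
theorem eq_zero_of_bessel_of_tendsto {f f' : ℂ → ℂ}
    (hf : ∀ z ∈ upperHalf, HasDerivAt f (f' z) z)
    (hf' : ∀ z ∈ upperHalf, HasDerivAt f' (-(f' z / z) - f z) z) {l : Filter ℂ} [l.NeBot]
    (hl : l ≤ 𝓝[upperHalf] 0) (h0 : Tendsto f l (𝓝 0)) (h1 : Tendsto (fun z => z * f' z) l (𝓝 0)) :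
    ∀ z ∈ upperHalf, f z = 0 := by
  have hlU : ∀ᶠ z in l, z ∈ upperHalf := hl self_mem_nhdsWithin
  have hJ := tendsto_besselJ0.mono_left hl
  have hJ' := tendsto_besselJ0Deriv.mono_left hl
  have hz := tendsto_id_upperHalf.mono_left hl
  -- Near 0, J₀ → 1 and J₀' → 0, so the hypotheses on f and z f' make the Wronskian with J₀ vanish
  -- identically.
  have hW := wronskian_const hf hf' (fun z _ => hasDerivAt_besselJ0 z)
    (fun z hz => hasDerivAt_besselJ0Deriv (ne_zero_of_im_pos hz)) hlU (c := 0) (by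
      have := ((hz.mul h0).mul hJ').sub (h1.mul hJ)
      simp only [zero_mul, sub_zero] at this
      refine this.congr fun z => ?_
      ring)
  -- The quotient f/J₀ is only usable where J₀ ≠ 0. It is constant, hence zero, on a half disc at
  -- the origin; analyticity then carries f = 0 to the whole half plane.
  have hev : ∀ᶠ z in 𝓝 (0 : ℂ), besselJ0 z ≠ 0 := by
    have hc := (hasDerivAt_besselJ0 0).continuousAt
    refine hc.eventually_ne ?_
    rw [besselJ0_eq]; simp [seriesSum_zero, coeffJ_zero]
  obtain ⟨η, hη, hball⟩ := Metric.eventually_nhds_iff_ball.1 hev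
  have hopen : IsOpen (upperHalf ∩ Metric.ball 0 η) := isOpen_upperHalf.inter Metric.isOpen_ball
  have hd : ∀ z ∈ upperHalf ∩ Metric.ball 0 η, HasDerivAt (fun z => f z / besselJ0 z) 0 z := by
    intro z hz
    convert! (hf z hz.1).div (hasDerivAt_besselJ0 z) (hball z hz.2) using 1
    have h := hW z hz.1
    rcases mul_eq_zero.1 h with h | h
    · exact absurd h (ne_zero_of_im_pos hz.1)
    · have : f' z * besselJ0 z - f z * besselJ0Deriv z = 0 := by linear_combination -h
      rw [this, zero_div]
  have hzero : ∀ z ∈ upperHalf ∩ Metric.ball 0 η, f z = 0 := by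
    intro z hz
    have hlim := h0.div hJ one_ne_zero
    have hlB : ∀ᶠ w in l, w ∈ upperHalf ∩ Metric.ball 0 η := by
      filter_upwards [hlU, hl (mem_nhdsWithin_of_mem_nhds (Metric.ball_mem_nhds 0 hη))] with w h1 h2
        using ⟨h1, h2⟩
    have : f z / besselJ0 z = 0 / 1 := by
      refine tendsto_nhds_unique (Filter.Tendsto.congr' ?_ tendsto_const_nhds) hlim
      filter_upwards [hlB] with w hw
      exact hopen.is_const_of_deriv_eq_zero
        (convex_upperHalf.inter (convex_ball 0 η)).isPreconnected
        (fun z hz => (hd z hz).differentiableAt.differentiableWithinAt)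
        (fun z hz => (hd z hz).deriv) hz hw
    simpa [hball z hz.2] using this
  obtain ⟨z₀, hz₀⟩ : (upperHalf ∩ Metric.ball 0 η).Nonempty := by
    refine ⟨(η / 2 : ℝ) * Complex.I, by simp [upperHalf, hη], ?_⟩
    rw [mem_ball_zero_iff]
    simp [abs_of_pos hη, hη]
  have han : AnalyticOnNhd ℂ f upperHalf := DifferentiableOn.analyticOnNhd
    (fun z hz => (hf z hz).differentiableAt.differentiableWithinAt) isOpen_upperHalf
  exact han.eqOn_zero_of_preconnected_of_eventuallyEq_zero convex_upperHalf.isPreconnected hz₀.1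
    (by filter_upwards [hopen.mem_nhds hz₀] with z hz using hzero z hz)

/-! ### The integral `∫ e^{iz cosh t} dt` -/

theorem one_add_sq_div_four_le_cosh (t : ℝ) : 1 + t ^ 2 / 4 ≤ Real.cosh t := by
  rw [← Real.cosh_abs, ← sq_abs t, Real.cosh_eq]
  have h1 := Real.quadratic_le_exp_of_nonneg (abs_nonneg t)
  have h2 := Real.add_one_le_exp (-|t|)
  linarith

/-- Half of the exponent absorbs coshⁿ t; the other half is dominated by a Gaussian, since (b/2)
cosh t ≥ (b/8) t². -/
theorem integrable_cosh_pow_mul_exp {b : ℝ} (hb : 0 < b) (n : ℕ) :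
    Integrable fun t : ℝ => Real.cosh t ^ n * Real.exp (-(b * Real.cosh t)) := by
  have hg := (integrable_exp_neg_mul_sq (b := b / 8) (by positivity)).const_mul
    ((n.factorial : ℝ) * (2 / b) ^ n)
  refine hg.mono' (by fun_prop) (Eventually.of_forall fun t => ?_)
  have hc := Real.cosh_pos t
  rw [Real.norm_of_nonneg (by positivity)]
  have h1 := Real.pow_div_factorial_le_exp (b / 2 * Real.cosh t) (by positivity) n
  rw [div_le_iff₀ (by positivity)] at h1
  have h2 : Real.cosh t ^ n ≤
      Real.exp (b / 2 * Real.cosh t) * ((n.factorial : ℝ) * (2 / b) ^ n) := by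
    calc Real.cosh t ^ n = (b / 2 * Real.cosh t) ^ n * (2 / b) ^ n := by
          rw [← mul_pow]; congr 1; field_simp
      _ ≤ Real.exp (b / 2 * Real.cosh t) * n.factorial * (2 / b) ^ n := by gcongr
      _ = _ := by ring
  have h3 : Real.exp (b / 2 * Real.cosh t) * Real.exp (-(b * Real.cosh t))
      ≤ Real.exp (-(b / 8) * t ^ 2) := by
    rw [← Real.exp_add]
    apply Real.exp_le_exp.2
    nlinarith [one_add_sq_div_four_le_cosh t]
  calc Real.cosh t ^ n * Real.exp (-(b * Real.cosh t))
      ≤ Real.exp (b / 2 * Real.cosh t) * ((n.factorial : ℝ) * (2 / b) ^ n)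
        * Real.exp (-(b * Real.cosh t)) := by gcongr
    _ = (n.factorial : ℝ) * (2 / b) ^ n
        * (Real.exp (b / 2 * Real.cosh t) * Real.exp (-(b * Real.cosh t))) := by ring
    _ ≤ _ := by gcongr

/-- The integral `∫ (cosh t)ⁿ e^{iz cosh t} dt`. -/
noncomputable def coshIntegral (n : ℕ) (z : ℂ) : ℂ :=
  ∫ t : ℝ, (Real.cosh t : ℂ) ^ n * Complex.exp (Complex.I * z * Real.cosh t)

theorem norm_coshIntegrand (n : ℕ) (z : ℂ) (t : ℝ) :
    ‖(Real.cosh t : ℂ) ^ n * Complex.exp (Complex.I * z * Real.cosh t)‖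
      = Real.cosh t ^ n * Real.exp (-(z.im * Real.cosh t)) := by
  rw [norm_mul, norm_pow, Complex.norm_real, Real.norm_of_nonneg (Real.cosh_pos t).le,
    Complex.norm_exp]
  congr 2
  simp [Complex.mul_re, Complex.cosh_ofReal_re, Complex.cosh_ofReal_im]

theorem continuous_coshIntegrand (n : ℕ) (z : ℂ) :
    Continuous fun t : ℝ => (Real.cosh t : ℂ) ^ n * Complex.exp (Complex.I * z * Real.cosh t) := by
  have : Continuous fun t : ℝ => (Real.cosh t : ℂ) :=
    Complex.continuous_ofReal.comp Real.continuous_cosh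
  fun_prop

theorem integrable_coshIntegrand (n : ℕ) {z : ℂ} (hz : z ∈ upperHalf) :
    Integrable fun t : ℝ =>
      (Real.cosh t : ℂ) ^ n * Complex.exp (Complex.I * z * Real.cosh t) := by
  refine (integrable_cosh_pow_mul_exp hz n).mono' (continuous_coshIntegrand n z).aestronglyMeasurable
    (Eventually.of_forall fun t => (norm_coshIntegrand n z t).le)

theorem hasDerivAt_coshIntegral (n : ℕ) {z : ℂ} (hz : z ∈ upperHalf) :
    HasDerivAt (coshIntegral n) (Complex.I * coshIntegral (n + 1) z) z := by
  have hz' : 0 < z.im := hz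
  have hs : {w : ℂ | z.im / 2 < w.im} ∈ 𝓝 z :=
    (isOpen_lt continuous_const Complex.continuous_im).mem_nhds (by simp [hz'])
  have h := (hasDerivAt_integral_of_dominated_loc_of_deriv_le (μ := volume) (𝕜 := ℂ)
    (F := fun z t => (Real.cosh t : ℂ) ^ n * Complex.exp (Complex.I * z * Real.cosh t))
    (F' := fun z t => Complex.I *
      ((Real.cosh t : ℂ) ^ (n + 1) * Complex.exp (Complex.I * z * Real.cosh t)))
    (bound := fun t => Real.cosh t ^ (n + 1) * Real.exp (-(z.im / 2 * Real.cosh t))) hs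
    (Eventually.of_forall fun w => (continuous_coshIntegrand n w).aestronglyMeasurable)
    (integrable_coshIntegrand n hz)
    (continuous_const.mul (continuous_coshIntegrand (n + 1) z)).aestronglyMeasurable
    (Eventually.of_forall fun t w hw => ?_) (integrable_cosh_pow_mul_exp (half_pos hz') (n + 1))
    (Eventually.of_forall fun t w _ => ?_)).2
  · convert! h using 1
    rw [coshIntegral, ← integral_const_mul]
  · have hw : z.im / 2 < w.im := hw
    have hc := Real.cosh_pos t
    rw [norm_mul, Complex.norm_I, one_mul, norm_coshIntegrand]
    gcongr
  · have h1 : HasDerivAt (fun w : ℂ => Complex.I * w * Real.cosh t)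
        (Complex.I * 1 * Real.cosh t) w :=
      ((hasDerivAt_id w).const_mul Complex.I).mul_const _
    convert! (h1.cexp).const_mul ((Real.cosh t : ℂ) ^ n) using 1
    ring

/-- This is Bessel's equation for the integral of order 0, since d/dz inserts a factor i cosh t. It
results from integrating the total derivative of i sinh t · e^{iz cosh t} and using sinh² = cosh² -
1. -/
theorem coshIntegral_ode {z : ℂ} (hz : z ∈ upperHalf) :
    z * coshIntegral 2 z = Complex.I * coshIntegral 1 z + z * coshIntegral 0 z := by
  set e : ℝ → ℂ := fun t => Complex.exp (Complex.I * z * Real.cosh t) with he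
  have hcosh : ∀ t : ℝ, HasDerivAt (fun t : ℝ => (Real.cosh t : ℂ)) (Real.sinh t : ℂ) t := fun t =>
    (Real.hasDerivAt_cosh t).ofReal_comp
  have hsinh : ∀ t : ℝ, HasDerivAt (fun t : ℝ => (Real.sinh t : ℂ)) (Real.cosh t : ℂ) t := fun t =>
    (Real.hasDerivAt_sinh t).ofReal_comp
  have hsq : ∀ t : ℝ, (Real.sinh t : ℂ) ^ 2 = (Real.cosh t : ℂ) ^ 2 - 1 := fun t => by
    have := Real.sinh_sq t
    exact_mod_cast congrArg Complex.ofReal this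
  have i0 := integrable_coshIntegrand 0 hz
  have i1 := integrable_coshIntegrand 1 hz
  have i2 := integrable_coshIntegrand 2 hz
  have hd : ∀ t, HasDerivAt (fun t : ℝ => Complex.I * Real.sinh t * e t)
      (Complex.I * ((Real.cosh t : ℂ) ^ 1 * e t) + z * ((Real.cosh t : ℂ) ^ 0 * e t)
        - z * ((Real.cosh t : ℂ) ^ 2 * e t)) t := by
    intro t
    convert! ((hsinh t).const_mul Complex.I).mul
      (((hcosh t).const_mul (Complex.I * z)).cexp) using 1
    have := hsq t
    simp only [he]
    linear_combination (z * Complex.exp (Complex.I * z * Real.cosh t)) * this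
      - z * Real.sinh t ^ 2 * Complex.exp (Complex.I * z * Real.cosh t) * Complex.I_sq
  have hi : Integrable fun t : ℝ => Complex.I * Real.sinh t * e t := by
    refine i1.norm.mono' ?_ (Eventually.of_forall fun t => ?_)
    · refine Continuous.aestronglyMeasurable ?_
      exact continuous_iff_continuousAt.2 fun t => (hd t).continuousAt
    · rw [norm_mul, norm_mul, norm_mul, Complex.norm_I, one_mul, pow_one, Complex.norm_real,
        Complex.norm_real]
      have : ‖Real.sinh t‖ ≤ ‖Real.cosh t‖ := by
        rw [Real.norm_eq_abs, Real.norm_eq_abs, ← sq_le_sq, Real.sinh_sq]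
        linarith
      gcongr
  have i01 : Integrable fun t : ℝ =>
      Complex.I * ((Real.cosh t : ℂ) ^ 1 * e t) + z * ((Real.cosh t : ℂ) ^ 0 * e t) :=
    (i1.const_mul _).add (i0.const_mul _)
  have h := integral_eq_zero_of_hasDerivAt_of_integrable hd (i01.sub (i2.const_mul _)) hi
  rw [integral_sub i01 (i2.const_mul _), integral_add (i1.const_mul _) (i0.const_mul _)] at h
  simp only [integral_const_mul] at h
  exact (sub_eq_zero.1 h).symm

/-! ### Behaviour of the integral at the origin -/

/-- Substitution s = (y/2) eᵗ, under which y cosh t = s + y²/(4s). The right-hand exponential is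
then a regularized e^{-s}, with an explicit limit as y → 0. -/
theorem integral_mul_regularized_exp {y : ℝ} (hy : 0 < y) (g : ℝ → ℝ) :
    ∫ s in Ioi (0 : ℝ), g s * Real.exp (-s - y ^ 2 / 4 / s) =
      ∫ t : ℝ, y / 2 * Real.exp t * g (y / 2 * Real.exp t) * Real.exp (-(y * Real.cosh t)) := by
  have himg : (fun t : ℝ => y / 2 * Real.exp t) '' univ = Ioi 0 := by
    rw [image_univ]
    ext s
    refine ⟨?_, fun hs => ⟨Real.log (s / (y / 2)), ?_⟩⟩
    · rintro ⟨t, rfl⟩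
      exact mul_pos (half_pos hy) (Real.exp_pos t)
    · have hs : 0 < s := hs
      simp only
      rw [Real.exp_log (by positivity)]
      field_simp
  rw [← himg, integral_image_eq_integral_abs_deriv_smul (f' := fun t => y / 2 * Real.exp t)
    MeasurableSet.univ
    (fun t _ => ((Real.hasDerivAt_exp t).const_mul (y / 2)).hasDerivWithinAt)
    (fun a _ b _ h => by simpa [hy.ne'] using h), setIntegral_univ]
  refine integral_congr_ae (Eventually.of_forall fun t => ?_)
  have he := Real.exp_pos t
  simp only [smul_eq_mul]
  rw [abs_of_pos (by positivity), mul_assoc, mul_assoc, mul_assoc]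
  congr 4
  rw [Real.cosh_eq, Real.exp_neg]
  field_simp
  ring

theorem integral_odd_eq_zero {f : ℝ → ℝ} (hf : ∀ t, f (-t) = -f t) : ∫ t, f t = 0 := by
  have h := integral_neg_eq_self f volume
  simp only [hf, integral_neg] at h
  linarith

/-- The substitution yields eᵗ = cosh t + sinh t, and the odd part integrates to zero. -/
theorem integral_cosh_mul_exp {y : ℝ} (hy : 0 < y) :
    y * ∫ t : ℝ, Real.cosh t * Real.exp (-(y * Real.cosh t)) =
      2 * ∫ s in Ioi (0 : ℝ), Real.exp (-s - y ^ 2 / 4 / s) := by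
  have h := integral_mul_regularized_exp hy (fun _ => 1)
  simp only [one_mul, mul_one] at h
  have hodd : ∫ t : ℝ, Real.sinh t * Real.exp (-(y * Real.cosh t)) = 0 :=
    integral_odd_eq_zero fun t => by rw [Real.sinh_neg, Real.cosh_neg]; ring
  have i1 : Integrable fun t : ℝ => Real.cosh t * Real.exp (-(y * Real.cosh t)) := by
    simpa using integrable_cosh_pow_mul_exp hy 1
  have i2 : Integrable fun t : ℝ => Real.sinh t * Real.exp (-(y * Real.cosh t)) := by
    refine i1.mono' (by fun_prop) (Eventually.of_forall fun t => ?_)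
    rw [norm_mul, Real.norm_of_nonneg (Real.exp_pos _).le]
    gcongr
    rw [Real.norm_eq_abs]
    refine abs_le_of_sq_le_sq ?_ (Real.cosh_pos t).le
    rw [Real.sinh_sq]; linarith
  have e : ∫ t : ℝ, y / 2 * Real.exp t * Real.exp (-(y * Real.cosh t)) = y / 2 *
      ((∫ t : ℝ, Real.cosh t * Real.exp (-(y * Real.cosh t)))
        + ∫ t : ℝ, Real.sinh t * Real.exp (-(y * Real.cosh t))) := by
    rw [← integral_add i1 i2, ← integral_const_mul]
    refine integral_congr_ae (Eventually.of_forall fun t => ?_)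
    simp only
    rw [← Real.cosh_add_sinh t]; ring
  rw [h, e, hodd]
  ring

theorem abs_le_four_mul_cosh (t : ℝ) : |t| ≤ 4 * Real.cosh t := by
  have := one_add_sq_div_four_le_cosh t
  rw [abs_le]
  constructor <;> nlinarith [sq_nonneg (t + 1), sq_nonneg (t - 1)]

theorem abs_sinh_le_cosh (t : ℝ) : |Real.sinh t| ≤ Real.cosh t := by
  refine abs_le_of_sq_le_sq ?_ (Real.cosh_pos t).le
  rw [Real.sinh_sq]; linarith

/-- Integration by parts gives y ∫ t sinh t e^{-y cosh t} dt, where t sinh t may be replaced by t eᵗ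
because t cosh t is odd. Then t = log s - log(y/2) exhibits the logarithmic singularity at y = 0. -/
theorem integral_exp_cosh {y : ℝ} (hy : 0 < y) :
    ∫ t : ℝ, Real.exp (-(y * Real.cosh t)) =
      2 * (∫ s in Ioi (0 : ℝ), Real.log s * Real.exp (-s - y ^ 2 / 4 / s))
        - 2 * Real.log (y / 2) * ∫ s in Ioi (0 : ℝ), Real.exp (-s - y ^ 2 / 4 / s) := by
  have hM := integral_mul_regularized_exp hy (fun _ => 1)
  have hN := integral_mul_regularized_exp hy Real.log
  simp only [one_mul, mul_one] at hM
  have i0 : Integrable fun t : ℝ => Real.exp (-(y * Real.cosh t)) := by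
    simpa using integrable_cosh_pow_mul_exp hy 0
  have i1 : Integrable fun t : ℝ => Real.cosh t * Real.exp (-(y * Real.cosh t)) := by
    simpa using integrable_cosh_pow_mul_exp hy 1
  have i2 := (integrable_cosh_pow_mul_exp hy 2).const_mul 4
  have iw : ∀ w : ℝ → ℝ, Continuous w → (∀ t, |w t| ≤ 4 * Real.cosh t ^ 2) →
      Integrable fun t : ℝ => w t * Real.exp (-(y * Real.cosh t)) := by
    intro w hw hb
    refine i2.mono' (by fun_prop) (Eventually.of_forall fun t => ?_)
    rw [norm_mul, Real.norm_of_nonneg (Real.exp_pos _).le, Real.norm_eq_abs, ← mul_assoc]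
    gcongr
    exact hb t
  have hc1 := Real.one_le_cosh
  have its : Integrable fun t : ℝ => t * Real.sinh t * Real.exp (-(y * Real.cosh t)) := by
    refine iw (fun t => t * Real.sinh t) (by fun_prop) fun t => ?_
    rw [abs_mul]
    nlinarith [abs_le_four_mul_cosh t, abs_sinh_le_cosh t, abs_nonneg t, abs_nonneg (Real.sinh t),
      hc1 t]
  have itc : Integrable fun t : ℝ => t * Real.cosh t * Real.exp (-(y * Real.cosh t)) := by
    refine iw (fun t => t * Real.cosh t) (by fun_prop) fun t => ?_
    rw [abs_mul, abs_of_pos (Real.cosh_pos t)]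
    nlinarith [abs_le_four_mul_cosh t, hc1 t]
  have it : Integrable fun t : ℝ => t * Real.exp (-(y * Real.cosh t)) := by
    refine iw (fun t => t) (by fun_prop) fun t => ?_
    nlinarith [abs_le_four_mul_cosh t, hc1 t]
  have ie : Integrable fun t : ℝ => Real.exp t * Real.exp (-(y * Real.cosh t)) := by
    refine iw (fun t => Real.exp t) (by fun_prop) fun t => ?_
    rw [← Real.cosh_add_sinh, abs_of_nonneg (by rw [Real.cosh_add_sinh]; positivity)]
    nlinarith [(abs_le.1 (abs_sinh_le_cosh t)).2, hc1 t]
  have ite : Integrable fun t : ℝ => t * Real.exp t * Real.exp (-(y * Real.cosh t)) := by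
    refine (itc.add its).congr (Eventually.of_forall fun t => ?_)
    simp only [Pi.add_apply]
    rw [← Real.cosh_add_sinh t]; ring
  have hparts : ∫ t : ℝ, Real.exp (-(y * Real.cosh t))
      = y * ∫ t : ℝ, t * Real.sinh t * Real.exp (-(y * Real.cosh t)) := by
    have hd : ∀ t : ℝ, HasDerivAt (fun t : ℝ => t * Real.exp (-(y * Real.cosh t)))
        (Real.exp (-(y * Real.cosh t)) - y * (t * Real.sinh t * Real.exp (-(y * Real.cosh t)))) t := by
      intro t
      convert! (hasDerivAt_id t).mul (((Real.hasDerivAt_cosh t).const_mul y).neg.exp) using 1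
      simp
      ring
    have := integral_eq_zero_of_hasDerivAt_of_integrable hd (i0.sub (its.const_mul y)) it
    rw [integral_sub i0 (its.const_mul y), integral_const_mul] at this
    linarith
  have hodd : ∫ t : ℝ, t * Real.cosh t * Real.exp (-(y * Real.cosh t)) = 0 :=
    integral_odd_eq_zero fun t => by rw [Real.cosh_neg]; ring
  have h3 : ∫ t : ℝ, t * Real.exp t * Real.exp (-(y * Real.cosh t))
      = ∫ t : ℝ, t * Real.sinh t * Real.exp (-(y * Real.cosh t)) := by
    rw [← zero_add (∫ t : ℝ, t * Real.sinh t * Real.exp (-(y * Real.cosh t))), ← hodd,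
      ← integral_add itc its]
    refine integral_congr_ae (Eventually.of_forall fun t => ?_)
    simp only
    rw [← Real.cosh_add_sinh t]; ring
  have h4 : ∫ t : ℝ, y / 2 * Real.exp t * Real.log (y / 2 * Real.exp t)
        * Real.exp (-(y * Real.cosh t))
      = Real.log (y / 2) * (∫ t : ℝ, y / 2 * Real.exp t * Real.exp (-(y * Real.cosh t)))
        + y / 2 * ∫ t : ℝ, t * Real.exp t * Real.exp (-(y * Real.cosh t)) := by
    have ie' : Integrable fun t : ℝ => y / 2 * Real.exp t * Real.exp (-(y * Real.cosh t)) := by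
      simpa only [mul_assoc] using ie.const_mul (y / 2)
    rw [← integral_const_mul, ← integral_const_mul, ← integral_add (ie'.const_mul _)
      (ite.const_mul _)]
    refine integral_congr_ae (Eventually.of_forall fun t => ?_)
    simp only
    rw [Real.log_mul (by positivity) (Real.exp_pos t).ne', Real.log_exp]
    ring
  rw [hN, hM, h4, h3, hparts]
  ring

theorem integrableOn_rpow_mul_exp_neg {a : ℝ} (ha : -1 < a) :
    IntegrableOn (fun s : ℝ => Real.exp (-s) * s ^ a) (Ioi 0) := by
  have h := Real.GammaIntegral_convergent (s := a + 1) (by linarith)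
  simpa using h

theorem integrableOn_log_mul_exp_neg :
    IntegrableOn (fun s : ℝ => |Real.log s| * Real.exp (-s)) (Ioi 0) := by
  have h1 := integrableOn_rpow_mul_exp_neg (a := 1) (by norm_num)
  have h2 := (integrableOn_rpow_mul_exp_neg (a := -(1 / 2)) (by norm_num)).const_mul 2
  refine (h1.add h2).mono' (by fun_prop) ?_
  filter_upwards [ae_restrict_mem measurableSet_Ioi] with s hs
  have hs : 0 < s := hs
  simp only [Pi.add_apply, Real.rpow_one]
  rw [Real.norm_of_nonneg (by positivity)]
  have hp : 0 < s ^ (-(1 / 2 : ℝ)) := by positivity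
  have hl1 : Real.log s ≤ s := (Real.log_le_sub_one_of_pos hs).trans (by linarith)
  have hl2 : -Real.log s ≤ 2 * s ^ (-(1 / 2 : ℝ)) := by
    have h := Real.log_le_sub_one_of_pos hp
    rw [Real.log_rpow hs] at h
    linarith
  -- The two terms dominate log s at infinity and at 0; each is a Gamma integrand after
  -- multiplication by e^{-s}.
  have : |Real.log s| ≤ s + 2 * s ^ (-(1 / 2 : ℝ)) := by
    rw [abs_le]; constructor <;> linarith
  nlinarith [mul_le_mul_of_nonneg_right this (Real.exp_pos (-s)).le]

/-- This is Γ'(1), obtained by differentiating the Gamma integral; it is the source of Euler's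
constant in the matching with Y₀. -/
theorem integral_log_mul_exp_neg :
    ∫ s in Ioi (0 : ℝ), Real.log s * Real.exp (-s) = -Real.eulerMascheroniConstant := by
  have h1 := Complex.hasDerivAt_GammaIntegral (s := 1) (by simp)
  have h2 : HasDerivAt Complex.GammaIntegral (-(Real.eulerMascheroniConstant : ℂ)) 1 := by
    refine Complex.hasDerivAt_Gamma_one.congr_of_eventuallyEq ?_
    have : {s : ℂ | 0 < s.re} ∈ 𝓝 (1 : ℂ) :=
      (isOpen_lt continuous_const Complex.continuous_re).mem_nhds (by simp)
    filter_upwards [this] with s hs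
    exact (Complex.Gamma_eq_integral hs).symm
  have h := h1.unique h2
  simp only [sub_self, Complex.cpow_zero, one_mul, ← Complex.ofReal_mul, integral_complex_ofReal]
    at h
  exact_mod_cast h

theorem tendsto_regularized_exp {s : ℝ} :
    Tendsto (fun y : ℝ => Real.exp (-s - y ^ 2 / 4 / s)) (𝓝[>] 0) (𝓝 (Real.exp (-s))) := by
  have h : Continuous fun y : ℝ => Real.exp (-s - y ^ 2 / 4 / s) := by fun_prop
  have := h.tendsto 0
  norm_num at this
  exact this.mono_left nhdsWithin_le_nhds

theorem regularized_exp_le (y : ℝ) {s : ℝ} (hs : 0 < s) :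
    Real.exp (-s - y ^ 2 / 4 / s) ≤ Real.exp (-s) := by
  apply Real.exp_le_exp.2
  have : 0 ≤ y ^ 2 / 4 / s := by positivity
  linarith

theorem tendsto_integral_log_mul_exp :
    Tendsto (fun y : ℝ => ∫ s in Ioi (0 : ℝ), Real.log s * Real.exp (-s - y ^ 2 / 4 / s)) (𝓝[>] 0)
      (𝓝 (-Real.eulerMascheroniConstant)) := by
  rw [← integral_log_mul_exp_neg]
  refine tendsto_integral_filter_of_dominated_convergence
    (fun s => |Real.log s| * Real.exp (-s)) (Eventually.of_forall fun y => ?_)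
    (Eventually.of_forall fun y => ?_) integrableOn_log_mul_exp_neg
    (Eventually.of_forall fun s => tendsto_regularized_exp.const_mul _)
  · exact Measurable.aestronglyMeasurable (by fun_prop)
  · filter_upwards [ae_restrict_mem measurableSet_Ioi] with s hs
    rw [norm_mul, Real.norm_eq_abs, Real.norm_of_nonneg (Real.exp_pos _).le]
    exact mul_le_mul_of_nonneg_left (regularized_exp_le y hs) (abs_nonneg _)

theorem one_sub_exp_neg_sq_le {x : ℝ} (hx : 0 ≤ x) : 1 - Real.exp (-x ^ 2) ≤ x := by
  rcases le_total x 1 with h | h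
  · have := Real.add_one_le_exp (-x ^ 2)
    nlinarith
  · linarith [Real.exp_pos (-x ^ 2)]

/-- A rate is needed because the difference will be multiplied by log(y/2). From 1 - e^{-x²} ≤ x
with x = (y/2) s^{-1/2} the rate is linear in y; the sharper bound x² would bring in s⁻¹, not
integrable at 0. -/
theorem abs_integral_exp_sub_one_le {y : ℝ} (hy : 0 < y) :
    |(∫ s in Ioi (0 : ℝ), Real.exp (-s - y ^ 2 / 4 / s)) - 1| ≤
      y * ∫ s in Ioi (0 : ℝ), Real.exp (-s) * s ^ (-(1 / 2 : ℝ)) := by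
  have i1 : IntegrableOn (fun s : ℝ => Real.exp (-s)) (Ioi 0) := integrableOn_exp_neg_Ioi 0
  have i2 : IntegrableOn (fun s : ℝ => Real.exp (-s - y ^ 2 / 4 / s)) (Ioi 0) := by
    refine i1.mono' (Measurable.aestronglyMeasurable (by fun_prop)) ?_
    filter_upwards [ae_restrict_mem measurableSet_Ioi] with s hs
    rw [Real.norm_of_nonneg (Real.exp_pos _).le]
    exact regularized_exp_le y hs
  have e1 : ∫ s in Ioi (0 : ℝ), Real.exp (-s) = 1 := integral_exp_neg_Ioi_zero
  have i3 := (integrableOn_rpow_mul_exp_neg (a := -(1 / 2)) (by norm_num)).const_mul y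
  have e2 : (∫ s in Ioi (0 : ℝ), Real.exp (-s - y ^ 2 / 4 / s)) - 1
      = ∫ s in Ioi (0 : ℝ), (Real.exp (-s - y ^ 2 / 4 / s) - Real.exp (-s)) := by
    rw [integral_sub i2 i1, e1]
  rw [e2, ← Real.norm_eq_abs, ← integral_const_mul]
  refine norm_integral_le_of_norm_le i3 ?_
  filter_upwards [ae_restrict_mem measurableSet_Ioi] with s hs
  have hs : 0 < s := hs
  have hp : 0 < s ^ (-(1 / 2 : ℝ)) := by positivity
  have hsq : (s ^ (-(1 / 2 : ℝ))) ^ 2 = s⁻¹ := by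
    rw [← Real.rpow_natCast, ← Real.rpow_mul hs.le, ← Real.rpow_neg_one]; norm_num
  have h1 := one_sub_exp_neg_sq_le (x := y / 2 * s ^ (-(1 / 2 : ℝ))) (by positivity)
  rw [mul_pow, hsq] at h1
  rw [Real.norm_eq_abs, abs_sub_comm, abs_of_nonneg (by linarith [regularized_exp_le y hs])]
  have e3 : Real.exp (-s - y ^ 2 / 4 / s) = Real.exp (-s) * Real.exp (-((y / 2) ^ 2 * s⁻¹)) := by
    rw [← Real.exp_add]; congr 1; field_simp; ring
  rw [e3]
  have := mul_le_mul_of_nonneg_left h1 (Real.exp_pos (-s)).le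
  have h3 : 0 ≤ y * (Real.exp (-s) * s ^ (-(1 / 2 : ℝ))) := by positivity
  rw [← neg_mul] at *
  nlinarith

theorem tendsto_integral_exp :
    Tendsto (fun y : ℝ => ∫ s in Ioi (0 : ℝ), Real.exp (-s - y ^ 2 / 4 / s)) (𝓝[>] 0) (𝓝 1) := by
  rw [tendsto_iff_norm_sub_tendsto_zero]
  refine squeeze_zero' (Eventually.of_forall fun y => norm_nonneg _)
    (g := fun y => y * ∫ s in Ioi (0 : ℝ), Real.exp (-s) * s ^ (-(1 / 2 : ℝ))) ?_ ?_
  · filter_upwards [self_mem_nhdsWithin] with y hy using abs_integral_exp_sub_one_le hy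
  · have h : Tendsto (fun y : ℝ => y) (𝓝[>] 0) (𝓝 0) := nhdsWithin_le_nhds
    simpa using h.mul_const (∫ s in Ioi (0 : ℝ), Real.exp (-s) * s ^ (-(1 / 2 : ℝ)))

theorem tendsto_mul_log_half :
    Tendsto (fun y : ℝ => Real.log (y / 2) * y) (𝓝[>] 0) (𝓝 0) := by
  have h1 : Tendsto (fun y : ℝ => y / 2) (𝓝[>] 0) (𝓝[>] 0) := by
    refine tendsto_nhdsWithin_iff.2 ⟨?_, ?_⟩
    · have h : Tendsto (fun y : ℝ => y) (𝓝[>] 0) (𝓝 0) := nhdsWithin_le_nhds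
      simpa using h.div_const 2
    · filter_upwards [self_mem_nhdsWithin] with y hy using half_pos (show 0 < y from hy)
  have h2 := ((tendsto_log_mul_rpow_nhdsGT_zero zero_lt_one).comp h1).mul_const 2
  simp only [Function.comp_def, Real.rpow_one, zero_mul] at h2
  refine h2.congr fun y => by ring

theorem tendsto_log_mul_integral_exp_sub_one :
    Tendsto (fun y : ℝ => Real.log (y / 2) *
      ((∫ s in Ioi (0 : ℝ), Real.exp (-s - y ^ 2 / 4 / s)) - 1)) (𝓝[>] 0) (𝓝 0) := by
  refine squeeze_zero_norm' (a := fun y => |Real.log (y / 2) * y|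
    * ∫ s in Ioi (0 : ℝ), Real.exp (-s) * s ^ (-(1 / 2 : ℝ))) ?_ ?_
  · filter_upwards [self_mem_nhdsWithin] with y hy
    have hy : 0 < y := hy
    rw [norm_mul, abs_mul, abs_of_pos hy, mul_assoc, Real.norm_eq_abs, Real.norm_eq_abs]
    exact mul_le_mul_of_nonneg_left (abs_integral_exp_sub_one_le hy) (abs_nonneg _)
  · simpa using tendsto_mul_log_half.abs.mul_const
      (∫ s in Ioi (0 : ℝ), Real.exp (-s) * s ^ (-(1 / 2 : ℝ)))

theorem tendsto_integral_exp_cosh_add_log :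
    Tendsto (fun y : ℝ => (∫ t : ℝ, Real.exp (-(y * Real.cosh t))) + 2 * Real.log (y / 2))
      (𝓝[>] 0) (𝓝 (-2 * Real.eulerMascheroniConstant)) := by
  have h := (tendsto_integral_log_mul_exp.const_mul 2).sub
    (tendsto_log_mul_integral_exp_sub_one.const_mul 2)
  have e : 2 * -Real.eulerMascheroniConstant - 2 * 0 = -2 * Real.eulerMascheroniConstant := by ring
  rw [e] at h
  refine h.congr' ?_
  filter_upwards [self_mem_nhdsWithin] with y hy
  rw [integral_exp_cosh hy]
  ring

/-! ### The integral representation of `H₀⁽¹⁾` -/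

theorem coshIntegral_mul_I (n : ℕ) (y : ℝ) : coshIntegral n (y * Complex.I) =
    ((∫ t : ℝ, Real.cosh t ^ n * Real.exp (-(y * Real.cosh t)) : ℝ) : ℂ) := by
  rw [coshIntegral, ← integral_complex_ofReal]
  refine integral_congr_ae (Eventually.of_forall fun t => ?_)
  simp only
  rw [show Complex.I * (y * Complex.I) * Real.cosh t = ((-(y * Real.cosh t) : ℝ) : ℂ) by
    push_cast; linear_combination (y * Complex.cosh t) * Complex.I_sq]
  push_cast
  rfl

/-- Approach to the origin along the positive imaginary axis. -/
def imagAxis : Filter ℂ := map (fun y : ℝ => y * Complex.I) (𝓝[>] 0)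

instance : imagAxis.NeBot := by unfold imagAxis; infer_instance

theorem imagAxis_le : imagAxis ≤ 𝓝[upperHalf] 0 := by
  refine tendsto_nhdsWithin_iff.2 ⟨?_, ?_⟩
  · have h : Continuous fun y : ℝ => (y : ℂ) * Complex.I := by fun_prop
    have := h.tendsto 0
    simp only [Complex.ofReal_zero, zero_mul] at this
    exact this.mono_left nhdsWithin_le_nhds
  · filter_upwards [self_mem_nhdsWithin] with y hy
    have hy : 0 < y := hy
    simpa [upperHalf] using hy

/-- On z = iy one has log(z/2) = log(y/2) + iπ/2, and the imaginary part cancels the constant 1 in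
`hankelLog`. What remains is -2(log(y/2) + Euler's constant), matching the integral. -/
theorem tendsto_coshIntegral_sub_hankelLog :
    Tendsto (fun z => coshIntegral 0 z - Real.pi * Complex.I * hankelLog z) imagAxis (𝓝 0) := by
  rw [imagAxis, tendsto_map'_iff]
  have h := (Complex.continuous_ofReal.tendsto _).comp tendsto_integral_exp_cosh_add_log
  have h2 := h.add_const (2 * Real.eulerMascheroniConstant : ℂ)
  have e : ((-2 * Real.eulerMascheroniConstant : ℝ) : ℂ) + 2 * Real.eulerMascheroniConstant = 0 := by
    push_cast; ring
  rw [e] at h2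
  refine h2.congr' ?_
  filter_upwards [self_mem_nhdsWithin] with y hy
  have hy : 0 < y := hy
  have hlog : Complex.log (y * Complex.I / 2) = Real.log (y / 2) + Real.pi / 2 * Complex.I := by
    rw [show (y : ℂ) * Complex.I / 2 = ((y / 2 : ℝ) : ℂ) * Complex.I by push_cast; ring,
      Complex.log_ofReal_mul (by positivity) Complex.I_ne_zero, Complex.log_I]
  have hpi : (Real.pi : ℂ) ≠ 0 := by exact_mod_cast Real.pi_ne_zero
  simp only [Function.comp, coshIntegral_mul_I, hankelLog, hlog, pow_zero, one_mul]
  generalize Real.log (y / 2) = L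
  push_cast
  field_simp
  linear_combination (2 * (L + Real.eulerMascheroniConstant)
    + Real.pi * Complex.I) * Complex.I_sq

theorem tendsto_mul_coshIntegral_one :
    Tendsto (fun z => z * (Complex.I * coshIntegral 1 z)) imagAxis (𝓝 (-2)) := by
  rw [imagAxis, tendsto_map'_iff]
  have h := (Complex.continuous_ofReal.tendsto _).comp (tendsto_integral_exp.const_mul (-2))
  simp only [mul_one] at h
  have e : ((-2 : ℝ) : ℂ) = -2 := by norm_num
  rw [e] at h
  refine h.congr' ?_
  filter_upwards [self_mem_nhdsWithin] with y hy
  have := integral_cosh_mul_exp hy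
  have h2 : -2 * (∫ s in Ioi (0 : ℝ), Real.exp (-s - y ^ 2 / 4 / s))
      = -(y * ∫ t : ℝ, Real.cosh t ^ 1 * Real.exp (-(y * Real.cosh t))) := by
    simp only [pow_one]; linarith
  simp only [Function.comp, coshIntegral_mul_I, h2]
  push_cast
  linear_combination (-(y * ((∫ t : ℝ, Real.cosh t ^ 1 * Real.exp (-(y * Real.cosh t)) : ℝ) : ℂ)))
    * Complex.I_sq

/-- The difference of the two sides solves Bessel's equation and, along the imaginary axis, tends to
0 together with z times its derivative; `eq_zero_of_bessel_of_tendsto` then applies. -/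
theorem hankelH0_eq_coshIntegral {z : ℂ} (hz : z ∈ upperHalf) :
    Real.pi * Complex.I * hankelH0 z = coshIntegral 0 z := by
  have hpi : (Real.pi : ℂ) ≠ 0 := by exact_mod_cast Real.pi_ne_zero
  have h := eq_zero_of_bessel_of_tendsto
    (f := fun z => coshIntegral 0 z - Real.pi * Complex.I * hankelH0 z)
    (f' := fun z => Complex.I * coshIntegral 1 z - Real.pi * Complex.I * hankelH0Deriv z)
    (fun z hz => (hasDerivAt_coshIntegral 0 hz).sub ((hasDerivAt_hankelH0 hz).const_mul _))
    (fun z hz => by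
      convert! ((hasDerivAt_coshIntegral 1 hz).const_mul Complex.I).sub
        ((hasDerivAt_hankelH0Deriv hz).const_mul (Real.pi * Complex.I)) using 1
      have h1 := coshIntegral_ode hz
      have := ne_zero_of_im_pos hz
      field_simp
      linear_combination h1 - z * coshIntegral 2 z * Complex.I_sq)
    imagAxis_le ?_ ?_ z hz
  · exact (sub_eq_zero.1 h).symm
  · have := tendsto_coshIntegral_sub_hankelLog.sub
      ((tendsto_hankelH0_sub_log.mono_left imagAxis_le).const_mul (Real.pi * Complex.I))
    simp only [mul_zero, sub_zero] at this
    refine this.congr fun z => by ring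
  · have := tendsto_mul_coshIntegral_one.sub
      ((tendsto_mul_hankelH0Deriv.mono_left imagAxis_le).const_mul (Real.pi * Complex.I))
    have e : -2 - Real.pi * Complex.I * (2 * Complex.I / Real.pi) = 0 := by
      field_simp
      linear_combination (-2) * Complex.I_sq
    rw [e] at this
    refine this.congr fun z => by ring

theorem hankelH0Deriv_eq_coshIntegral {z : ℂ} (hz : z ∈ upperHalf) :
    Real.pi * hankelH0Deriv z = coshIntegral 1 z := by
  have h1 := (hasDerivAt_hankelH0 hz).const_mul (Real.pi * Complex.I)
  have h2 : HasDerivAt (fun z => Real.pi * Complex.I * hankelH0 z)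
      (Complex.I * coshIntegral 1 z) z := by
    refine (hasDerivAt_coshIntegral 0 hz).congr_of_eventuallyEq ?_
    filter_upwards [isOpen_upperHalf.mem_nhds hz] with w hw using hankelH0_eq_coshIntegral hw
  have := h1.unique h2
  exact mul_left_cancel₀ Complex.I_ne_zero (by linear_combination this)

/-! ### Behaviour at infinity along a ray of the upper half plane -/

theorem mul_mem_upperHalf {k : ℂ} (hk : 0 < k.im) {r : ℝ} (hr : 0 < r) : k * r ∈ upperHalf := by
  simpa [upperHalf] using mul_pos hk hr

theorem norm_coshIntegral_ray_le {k : ℂ} (hk : 0 < k.im) (n : ℕ) : ∃ C, 0 ≤ C ∧ ∀ r : ℝ, 1 ≤ r →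
    ‖coshIntegral n (k * r)‖ ≤ C * Real.exp (-(k.im * r)) := by
  refine ⟨Real.exp k.im * ∫ t : ℝ, Real.cosh t ^ n * Real.exp (-(k.im * Real.cosh t)), ?_, ?_⟩
  · refine mul_nonneg (Real.exp_pos _).le (integral_nonneg fun t => ?_)
    have := Real.cosh_pos t
    positivity
  · intro r hr
    rw [mul_right_comm, ← integral_const_mul]
    refine norm_integral_le_of_norm_le ((integrable_cosh_pow_mul_exp hk n).const_mul _)
      (Eventually.of_forall fun t => ?_)
    rw [norm_coshIntegrand]
    have hc := Real.one_le_cosh t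
    have him : (k * r).im = k.im * r := by simp
    have : Real.exp (-((k * r).im * Real.cosh t)) ≤
        Real.exp k.im * Real.exp (-(k.im * r)) * Real.exp (-(k.im * Real.cosh t)) := by
      rw [← Real.exp_add, ← Real.exp_add, him]
      apply Real.exp_le_exp.2
      -- From (r - 1)(cosh t - 1) ≥ 0 follows r cosh t ≥ r + cosh t - 1, which splits off the decay
      -- in r uniformly in t.
      nlinarith [mul_nonneg hk.le (mul_nonneg (sub_nonneg.2 hr) (sub_nonneg.2 hc))]
    calc Real.cosh t ^ n * Real.exp (-((k * r).im * Real.cosh t))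
        ≤ Real.cosh t ^ n *
          (Real.exp k.im * Real.exp (-(k.im * r)) * Real.exp (-(k.im * Real.cosh t))) := by gcongr
      _ = _ := by ring

theorem norm_hankelH0_ray_le {k : ℂ} (hk : 0 < k.im) : ∃ C, 0 ≤ C ∧ ∀ r : ℝ, 1 ≤ r →
    ‖hankelH0 (k * r)‖ ≤ C * Real.exp (-(k.im * r)) := by
  obtain ⟨C, hC0, hC⟩ := norm_coshIntegral_ray_le hk 0
  refine ⟨C, hC0, fun r hr => ?_⟩
  have h := hC r hr
  rw [← hankelH0_eq_coshIntegral (mul_mem_upperHalf hk (by linarith)), norm_mul, norm_mul,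
    Complex.norm_I, Complex.norm_real, Real.norm_of_nonneg Real.pi_pos.le] at h
  nlinarith [norm_nonneg (hankelH0 (k * r)), Real.pi_gt_three]

theorem norm_hankelH0Deriv_ray_le {k : ℂ} (hk : 0 < k.im) : ∃ C, 0 ≤ C ∧ ∀ r : ℝ, 1 ≤ r →
    ‖hankelH0Deriv (k * r)‖ ≤ C * Real.exp (-(k.im * r)) := by
  obtain ⟨C, hC0, hC⟩ := norm_coshIntegral_ray_le hk 1
  refine ⟨C, hC0, fun r hr => ?_⟩
  have h := hC r hr
  rw [← hankelH0Deriv_eq_coshIntegral (mul_mem_upperHalf hk (by linarith)), norm_mul,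
    Complex.norm_real, Real.norm_of_nonneg Real.pi_pos.le] at h
  nlinarith [norm_nonneg (hankelH0Deriv (k * r)), Real.pi_gt_three]

theorem wronskian_besselJ0_hankelH0 {z : ℂ} (hz : z ∈ upperHalf) :
    z * (besselJ0 z * hankelH0Deriv z - besselJ0Deriv z * hankelH0 z)
      = 2 * Complex.I / Real.pi := by
  have : (𝓝[upperHalf] (0 : ℂ)).NeBot := neBot_of_le imagAxis_le
  refine wronskian_const (fun z _ => hasDerivAt_besselJ0 z)
    (fun z hz => hasDerivAt_besselJ0Deriv (ne_zero_of_im_pos hz))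
    (fun z hz => hasDerivAt_hankelH0 hz) (fun z hz => hasDerivAt_hankelH0Deriv hz)
    (l := 𝓝[upperHalf] 0) self_mem_nhdsWithin ?_ z hz
  have := (tendsto_besselJ0.mul tendsto_mul_hankelH0Deriv).sub
    (tendsto_besselJ0Deriv.mul tendsto_mul_hankelH0)
  simp only [one_mul, mul_zero, sub_zero] at this
  refine this.congr fun z => by ring

/-- If |J₀| ≤ M on the ray, integrating (z J₀')' = -z J₀ bounds z J₀' by a multiple of r². Against
the exponential decay of H₀⁽¹⁾ and its derivative, z times the Wronskian would tend to 0, but it is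
the nonzero constant 2i/π. -/
theorem not_bounded_besselJ0_ray {k : ℂ} (hk : 0 < k.im) (C : ℝ) :
    ¬ ∀ᶠ r : ℝ in atTop, ‖besselJ0 (k * r)‖ ≤ C := by
  intro hC
  obtain ⟨R, hR⟩ := eventually_atTop.1 hC
  have hk0 : k ≠ 0 := ne_zero_of_im_pos hk
  have hcont : Continuous fun r : ℝ => besselJ0 (k * r) := by
    have : Continuous besselJ0 := continuous_iff_continuousAt.2 fun z =>
      (hasDerivAt_besselJ0 z).continuousAt
    fun_prop
  obtain ⟨C₁, hC₁⟩ := (isCompact_Icc (a := 0) (b := R)).exists_bound_of_continuousOn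
    hcont.continuousOn
  set M := max C C₁ with hM
  have hJ : ∀ r : ℝ, 0 ≤ r → ‖besselJ0 (k * r)‖ ≤ M := by
    intro r hr
    rcases le_total r R with h | h
    · exact (hC₁ r ⟨hr, h⟩).trans (le_max_right _ _)
    · exact (hR r h).trans (le_max_left _ _)
  have hM0 : 0 ≤ M := (norm_nonneg _).trans (hJ 0 le_rfl)
  have hJ' : ∀ r : ℝ, 0 ≤ r → ‖k * r * besselJ0Deriv (k * r)‖ ≤ ‖k‖ ^ 2 * r * M * r := by
    intro r hr
    have hd : ∀ x ∈ Icc (0 : ℝ) r, HasDerivWithinAt (fun x : ℝ => k * x * besselJ0Deriv (k * x))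
        (-(k ^ 2 * x * besselJ0 (k * x))) (Icc 0 r) x := by
      intro x _
      -- The equation for J₀' contains 1/z, so the endpoint 0 is treated apart; there J₀'(0) = 0
      -- makes the derivative of z J₀' vanish.
      rcases eq_or_ne x 0 with rfl | hx
      · have hdd : DifferentiableAt ℂ besselJ0Deriv 0 :=
          ((factorialDecay_coeffJ.derivCoeff.hasDerivAt_comp_sq 0).mul
            ((hasDerivAt_id (0 : ℂ)).div_const 2)).differentiableAt
        have h0 : besselJ0Deriv 0 = 0 := by simp [besselJ0Deriv]
        have h1 : HasDerivAt (fun z => z * besselJ0Deriv z) 0 (0 : ℂ) := by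
          convert! (hasDerivAt_id (0 : ℂ)).mul hdd.hasDerivAt using 1
          simp [h0]
        have h2 : HasDerivAt (fun x : ℝ => k * (x : ℂ)) k 0 := by
          simpa using (Complex.ofRealCLM.hasDerivAt (x := 0)).const_mul k
        have h3 := HasDerivAt.comp (0 : ℝ) (h₂ := fun z => z * besselJ0Deriv z)
          (h := fun x : ℝ => k * (x : ℂ)) (by simpa using h1) h2
        simpa [Function.comp_def] using h3.hasDerivWithinAt
      · have hkx : k * x ≠ 0 := mul_ne_zero hk0 (by exact_mod_cast hx)
        have h2 : HasDerivAt (fun x : ℝ => k * (x : ℂ)) k x := by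
          simpa using (Complex.ofRealCLM.hasDerivAt (x := x)).const_mul k
        have h3 := HasDerivAt.comp x ((hasDerivAt_id (k * x)).mul (hasDerivAt_besselJ0Deriv hkx)) h2
        refine HasDerivAt.hasDerivWithinAt ?_
        convert! h3 using 1
        have : (x : ℂ) ≠ 0 := by exact_mod_cast hx
        simp only [id]
        field_simp
        ring
    have hb : ∀ x ∈ Icc (0 : ℝ) r, ‖-(k ^ 2 * x * besselJ0 (k * x))‖ ≤ ‖k‖ ^ 2 * r * M := by
      intro x hx
      rw [norm_neg, norm_mul, norm_mul, norm_pow, Complex.norm_real, Real.norm_of_nonneg hx.1]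
      have := hJ x hx.1
      have := hx.2
      have := hx.1
      gcongr
    have := (convex_Icc (0 : ℝ) r).norm_image_sub_le_of_norm_hasDerivWithin_le hd hb
      (left_mem_Icc.2 hr) (right_mem_Icc.2 hr)
    simpa [abs_of_nonneg hr] using this
  obtain ⟨C₂, hC₂0, hC₂⟩ := norm_hankelH0_ray_le hk
  obtain ⟨C₃, hC₃0, hC₃⟩ := norm_hankelH0Deriv_ray_le hk
  have hlim : Tendsto (fun r : ℝ => ‖k‖ * M * C₃ * (r ^ 1 * Real.exp (-k.im * r))
      + ‖k‖ ^ 2 * M * C₂ * (r ^ 2 * Real.exp (-k.im * r))) atTop (𝓝 0) := by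
    have h0 : ∀ n : ℕ, Tendsto (fun r : ℝ => r ^ n * Real.exp (-k.im * r)) atTop (𝓝 0) := fun n => by
      simpa using tendsto_rpow_mul_exp_neg_mul_atTop_nhds_zero n k.im hk
    simpa using ((h0 1).const_mul (‖k‖ * M * C₃)).add ((h0 2).const_mul (‖k‖ ^ 2 * M * C₂))
  have hle : ∀ᶠ r : ℝ in atTop, ‖(2 * Complex.I / Real.pi : ℂ)‖ ≤
      ‖k‖ * M * C₃ * (r ^ 1 * Real.exp (-k.im * r))
      + ‖k‖ ^ 2 * M * C₂ * (r ^ 2 * Real.exp (-k.im * r)) := by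
    filter_upwards [eventually_ge_atTop 1] with r hr
    have hr0 : 0 < r := by linarith
    rw [← wronskian_besselJ0_hankelH0 (mul_mem_upperHalf hk hr0), mul_sub, ← mul_assoc, ← mul_assoc]
    refine (norm_sub_le _ _).trans ?_
    rw [norm_mul, norm_mul _ (hankelH0 (k * r)), norm_mul _ (besselJ0 (k * r)), norm_mul k,
      Complex.norm_real, Real.norm_of_nonneg hr0.le, neg_mul]
    have a1 := hJ r hr0.le
    have a2 := hJ' r hr0.le
    have a3 := hC₂ r hr
    have a4 := hC₃ r hr
    calc ‖k‖ * r * ‖besselJ0 (k * r)‖ * ‖hankelH0Deriv (k * r)‖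
          + ‖k * r * besselJ0Deriv (k * r)‖ * ‖hankelH0 (k * r)‖
        ≤ ‖k‖ * r * M * (C₃ * Real.exp (-(k.im * r)))
          + ‖k‖ ^ 2 * r * M * r * (C₂ * Real.exp (-(k.im * r))) := by gcongr
      _ = _ := by ring
  have := ge_of_tendsto hlim hle
  have hpos : 0 < ‖(2 * Complex.I / Real.pi : ℂ)‖ := by
    rw [norm_pos_iff]
    have : (Real.pi : ℂ) ≠ 0 := by exact_mod_cast Real.pi_ne_zero
    simp [this]
  linarith

variable {Ω Λ γ : ℝ} {Q kp kt k : ℂ}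

/-! ### Boundedness of radial fields -/

/-- The norm takes every nonnegative value since d ≥ 1, so no profile value for r ≥ 0 is missed. -/
theorem boundedAtInfinity_radial_iff (hd : 1 ≤ d) {f : ℝ → ℂ} :
    BoundedAtInfinity (fun x : E d => f ‖x‖) ↔ f =O[atTop] fun _ => (1 : ℝ) := by
  have : Nontrivial (E d) := by
    apply Module.nontrivial_of_finrank_pos (R := ℝ); simp; omega
  rw [isBigO_one_iff, IsBoundedUnder, IsBounded]
  simp only [eventually_map]
  refine exists_congr fun C => ?_
  rw [← comap_norm_atTop, eventually_comap]
  constructor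
  · intro h
    filter_upwards [h, eventually_ge_atTop 0] with r hr hr0
    obtain ⟨x, hx⟩ := exists_norm_eq (E d) hr0
    simpa [hx] using hr x hx
  · intro h
    filter_upwards [h] with r hr x hx
    rwa [hx]

theorem exists_testFunction (d : ℕ) :
    ∃ φ : E d → ℂ, ContDiff ℝ ∞ φ ∧ HasCompactSupport φ ∧ φ 0 = 1 := by
  let b : ContDiffBump (0 : E d) := ⟨1, 2, one_pos, one_lt_two⟩
  refine ⟨fun x => (b x : ℂ), Complex.ofRealCLM.contDiff.comp b.contDiff, ?_, ?_⟩
  · exact b.hasCompactSupport.comp_left (g := fun r : ℝ => (r : ℂ)) (by simp)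
  · have : b 0 = 1 := b.one_of_mem_closedBall (by simp [b])
    simp [this]

/-! ### Algebra of the mode parameters -/

theorem one_sub_ne_zero (γ Λ : ℝ) : (1 - Complex.I * γ * Λ : ℂ) ≠ 0 := by
  intro h
  have := congrArg Complex.re h
  simp at this

/-- The dispersion relation. Only q² enters the hypothesis, so q = Q and q = -Q cover the thermal
and acoustic wave numbers alike. -/
theorem wavenumber_quadratic (hΩ : Ω ≠ 0) {X q : ℂ}
    (hq : q ^ 2 = 4 * (Complex.I * Ω + γ * Ω * Λ)
      + (1 - Complex.I * γ * Ω - Complex.I * Λ) ^ 2)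
    (hX : X = Complex.I / (2 * Ω)
      * ((1 - Complex.I * γ * Ω - Complex.I * Λ + q) / (1 - Complex.I * γ * Λ))) :
    Ω * (1 - Complex.I * γ * Λ) * X ^ 2
      - Complex.I * (1 - Complex.I * γ * Ω - Complex.I * Λ) * X + Complex.I = 0 := by
  have hα := one_sub_ne_zero γ Λ
  have hΩ' : (Ω : ℂ) ≠ 0 := by exact_mod_cast hΩ
  have hq' : q = -2 * Complex.I * Ω * (1 - Complex.I * γ * Λ) * X
      - (1 - Complex.I * γ * Ω - Complex.I * Λ) := by
    have : X * (2 * Ω * (1 - Complex.I * γ * Λ))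
        = Complex.I * (1 - Complex.I * γ * Ω - Complex.I * Λ + q) := by
      rw [hX]; field_simp
    linear_combination Complex.I * this
      + (1 - Complex.I * γ * Ω - Complex.I * Λ + q) * Complex.I_sq
  rw [hq'] at hq
  have h4 : (4 * Ω * (1 - Complex.I * γ * Λ) : ℂ) ≠ 0 :=
    mul_ne_zero (mul_ne_zero (by norm_num) hΩ') hα
  apply mul_left_cancel₀ h4
  linear_combination (-1) * hq + (4 * Ω ^ 2 * (1 - Complex.I * γ * Λ) ^ 2 * X ^ 2
    - 4 * γ * Ω * Λ) * Complex.I_sq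

theorem modeRatio_temperature (hγ₀ : γ ≠ 0) (hγ₁ : γ ≠ 1) :
    Complex.I - Complex.I * ((γ - 1) / γ) * modeRatio Ω γ k = Ω * k ^ 2 := by
  have h0 : (γ : ℂ) ≠ 0 := by exact_mod_cast hγ₀
  have h1 : (γ - 1 : ℂ) ≠ 0 := by rw [sub_ne_zero]; exact_mod_cast hγ₁
  rw [modeRatio]
  field_simp
  linear_combination (-k ^ 2 * Ω) * Complex.I_sq

/-- While the temperature equation alone fixes m in terms of k, this identity is where k² must
satisfy the dispersion relation. -/
theorem modeRatio_pressure (hΩ : Ω ≠ 0) (hγ₁ : γ ≠ 1)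
    (hk : Ω * (1 - Complex.I * γ * Λ) * (k ^ 2) ^ 2
      - Complex.I * (1 - Complex.I * γ * Ω - Complex.I * Λ) * k ^ 2 + Complex.I = 0) :
    (γ * (1 - Λ / Ω) + Λ / Ω) * modeRatio Ω γ k - γ * (1 - Λ / Ω)
      = (1 - Complex.I * γ * Λ) * modeRatio Ω γ k * k ^ 2 := by
  have hΩ' : (Ω : ℂ) ≠ 0 := by exact_mod_cast hΩ
  have h1 : (γ - 1 : ℂ) ≠ 0 := by rw [sub_ne_zero]; exact_mod_cast hγ₁
  rw [modeRatio]
  generalize k ^ 2 = X at *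
  field_simp
  linear_combination (-Complex.I * Ω * γ) * hk
    + (Ω * γ * (1 - X * (1 - Complex.I * γ * Ω - Complex.I * Λ))) * Complex.I_sq

/-- The two squared wave numbers differ by a multiple of Q, hence so do the ratios; Q ≠ 0 will make
the modes independent. -/
theorem modeRatio_sub (hΩ : Ω ≠ 0) (hγ₁ : γ ≠ 1)
    (hkp : kp ^ 2 = acousticWavenumberSq Ω Λ γ Q) (hkt : kt ^ 2 = thermalWavenumberSq Ω Λ γ Q) :
    (modeRatio Ω γ kt - modeRatio Ω γ kp) * ((γ - 1) * (1 - Complex.I * γ * Λ)) = -(γ * Q) := by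
  have hΩ' : (Ω : ℂ) ≠ 0 := by exact_mod_cast hΩ
  have h1 : (γ - 1 : ℂ) ≠ 0 := by rw [sub_ne_zero]; exact_mod_cast hγ₁
  have hα := one_sub_ne_zero γ Λ
  rw [modeRatio, modeRatio, hkp, hkt, acousticWavenumberSq, thermalWavenumberSq]
  generalize (1 - Complex.I * γ * Λ : ℂ) = α at *
  field_simp
  linear_combination (γ * 2 * Q) * Complex.I_sq

/-! ### The Green's function for an abstract pair of radial functions -/

/-- `h (k r)` is, up to the factor `σ k`, a fundamental solution of the Helmholtz equation on
`ℝ^d` that is bounded at infinity, whereas `j (k r)` is unbounded there. -/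
structure IsRadialHelmholtzPair (d : ℕ) (j h σ : ℂ → ℂ) : Prop where
  locallyIntegrable : ∀ k : ℂ, 0 < k.im → LocallyIntegrable fun x : E d => h (k * ‖x‖)
  helmholtz : ∀ k : ℂ, 0 < k.im → ∀ φ : E d → ℂ, ContDiff ℝ ∞ φ → HasCompactSupport φ →
    ∫ x, h (k * ‖x‖) * (Laplacian.laplacian φ x + k ^ 2 * φ x) = σ k * φ 0
  bounded : ∀ k : ℂ, 0 < k.im → (fun r : ℝ => h (k * r)) =O[atTop] fun _ => (1 : ℝ)
  unbounded : ∀ k : ℂ, 0 < k.im → ¬ (fun r : ℝ => j (k * r)) =O[atTop] fun _ => (1 : ℝ)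

/-- The pair with profile `a (1, m_p) h(k_p r) + b (1, m_t) h(k_t r)`. -/
noncomputable def modePair (Ω γ : ℝ) (kp kt : ℂ) (h : ℂ → ℂ) (a b : ℂ) : ℝ → ℂ × ℂ := fun r =>
  (a * h (kp * r) + b * h (kt * r),
   a * modeRatio Ω γ kp * h (kp * r) + b * modeRatio Ω γ kt * h (kt * r))

/-- On the modes each equation is a linear combination of the two Helmholtz pairings, hence a
constant times φ(0). A test function with φ(0) = 1 turns the weak system into equality of constants.
-/
theorem IsRadialHelmholtzPair.isWeakDeltaSolution_iff {j h σ : ℂ → ℂ}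
    (H : IsRadialHelmholtzPair d j h σ) (hΩ : Ω ≠ 0) (hγ₀ : γ ≠ 0) (hγ₁ : γ ≠ 1)
    (hQ : Q ^ 2 = 4 * (Complex.I * Ω + γ * Ω * Λ)
      + (1 - Complex.I * γ * Ω - Complex.I * Λ) ^ 2)
    (hkp : kp ^ 2 = acousticWavenumberSq Ω Λ γ Q) (hkt : kt ^ 2 = thermalWavenumberSq Ω Λ γ Q)
    (hkp_im : 0 < kp.im) (hkt_im : 0 < kt.im) (a b : ℂ) :
    IsWeakDeltaSolution d Ω Λ γ (fun x => (modePair Ω γ kp kt h a b ‖x‖).1)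
        (fun x => (modePair Ω γ kp kt h a b ‖x‖).2) ↔
      Ω * (a * σ kp + b * σ kt) = 1 ∧
      (1 - Complex.I * γ * Λ) * (a * σ kp * modeRatio Ω γ kp + b * σ kt * modeRatio Ω γ kt)
        = -Complex.I * γ * (Λ / Ω) := by
  have tp := modeRatio_temperature (Ω := Ω) (k := kp) hγ₀ hγ₁
  have tt := modeRatio_temperature (Ω := Ω) (k := kt) hγ₀ hγ₁
  have pp := modeRatio_pressure hΩ hγ₁ (wavenumber_quadratic (q := -Q) hΩ (by rw [neg_sq, hQ])
    (by rw [hkp, acousticWavenumberSq, sub_eq_add_neg _ Q]))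
  have pt := modeRatio_pressure hΩ hγ₁ (wavenumber_quadratic hΩ hQ hkt)
  have Lp := H.locallyIntegrable kp hkp_im
  have Lt := H.locallyIntegrable kt hkt_im
  have comb : ∀ φ : E d → ℂ, ContDiff ℝ ∞ φ → HasCompactSupport φ → ∀ A B : ℂ,
      ∫ x, (A * (h (kp * ‖x‖) * (Laplacian.laplacian φ x + kp ^ 2 * φ x))
        + B * (h (kt * ‖x‖) * (Laplacian.laplacian φ x + kt ^ 2 * φ x)))
        = (A * σ kp + B * σ kt) * φ 0 := by
    intro φ hφ hφs A B
    have int : ∀ {k : ℂ}, LocallyIntegrable (fun x : E d => h (k * ‖x‖)) →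
        Integrable fun x : E d => h (k * ‖x‖) * (Laplacian.laplacian φ x + k ^ 2 * φ x) := by
      intro k hk
      have hc : Continuous fun x => Laplacian.laplacian φ x + k ^ 2 * φ x :=
        (continuous_laplacian hφ).add (continuous_const.mul hφ.continuous)
      have hs : HasCompactSupport fun x => Laplacian.laplacian φ x + k ^ 2 * φ x :=
        (hasCompactSupport_laplacian hφs).add hφs.mul_left
      simpa only [smul_eq_mul] using hk.integrable_smul_right_of_hasCompactSupport hc hs
    rw [integral_add ((int Lp).const_mul A) ((int Lt).const_mul B), integral_const_mul,
      integral_const_mul, H.helmholtz kp hkp_im φ hφ hφs, H.helmholtz kt hkt_im φ hφ hφs]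
    ring
  have e1 : ∀ φ : E d → ℂ, ContDiff ℝ ∞ φ → HasCompactSupport φ →
      (∫ x : E d, (Ω * (modePair Ω γ kp kt h a b ‖x‖).1 * Laplacian.laplacian φ x
        + (Complex.I * (modePair Ω γ kp kt h a b ‖x‖).1
          - Complex.I * ((γ - 1) / γ) * (modePair Ω γ kp kt h a b ‖x‖).2) * φ x))
      = Ω * (a * σ kp + b * σ kt) * φ 0 := by
    intro φ hφ hφs
    rw [show (Ω * (a * σ kp + b * σ kt) : ℂ) = Ω * a * σ kp + Ω * b * σ kt by ring,
      ← comb φ hφ hφs (Ω * a) (Ω * b)]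
    refine integral_congr_ae (Eventually.of_forall fun x => ?_)
    simp only [modePair]
    linear_combination a * h (kp * ‖x‖) * φ x * tp + b * h (kt * ‖x‖) * φ x * tt
  have e2 : ∀ φ : E d → ℂ, ContDiff ℝ ∞ φ → HasCompactSupport φ →
      (∫ x : E d, ((1 - Complex.I * γ * Λ) * (modePair Ω γ kp kt h a b ‖x‖).2
          * Laplacian.laplacian φ x
        + ((γ * (1 - Λ / Ω) + Λ / Ω) * (modePair Ω γ kp kt h a b ‖x‖).2
          - γ * (1 - Λ / Ω) * (modePair Ω γ kp kt h a b ‖x‖).1) * φ x))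
      = (1 - Complex.I * γ * Λ) * (a * σ kp * modeRatio Ω γ kp + b * σ kt * modeRatio Ω γ kt)
        * φ 0 := by
    intro φ hφ hφs
    rw [show (1 - Complex.I * γ * Λ) * (a * σ kp * modeRatio Ω γ kp + b * σ kt * modeRatio Ω γ kt)
        = (1 - Complex.I * γ * Λ) * a * modeRatio Ω γ kp * σ kp
          + (1 - Complex.I * γ * Λ) * b * modeRatio Ω γ kt * σ kt by ring,
      ← comb φ hφ hφs]
    refine integral_congr_ae (Eventually.of_forall fun x => ?_)
    simp only [modePair]
    linear_combination a * h (kp * ‖x‖) * φ x * pp + b * h (kt * ‖x‖) * φ x * pt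
  constructor
  · rintro ⟨-, -, hw⟩
    obtain ⟨φ, hφ, hφs, hφ0⟩ := exists_testFunction d
    obtain ⟨w1, w2⟩ := hw φ hφ hφs
    rw [e1 φ hφ hφs, hφ0, mul_one] at w1
    rw [e2 φ hφ hφs, hφ0, mul_one, mul_one] at w2
    exact ⟨w1, w2⟩
  · rintro ⟨w1, w2⟩
    refine ⟨?_, ?_, fun φ hφ hφs => ⟨?_, ?_⟩⟩
    · exact (Lp.smul a).add (Lt.smul b)
    · exact (Lp.smul (a * modeRatio Ω γ kp)).add (Lt.smul (b * modeRatio Ω γ kt))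
    · rw [e1 φ hφ hφs, w1, one_mul]
    · rw [e2 φ hφ hφs, w2]

/-- The source conditions have exactly one solution. -/
theorem source_conditions_iff (hΩ : Ω ≠ 0) (hγ₀ : γ ≠ 0) (hγ₁ : γ ≠ 1) (hQ₀ : Q ≠ 0)
    (hkp : kp ^ 2 = acousticWavenumberSq Ω Λ γ Q) (hkt : kt ^ 2 = thermalWavenumberSq Ω Λ γ Q)
    {A B : ℂ} :
    (Ω * (A + B) = 1 ∧
      (1 - Complex.I * γ * Λ) * (A * modeRatio Ω γ kp + B * modeRatio Ω γ kt)
        = -Complex.I * γ * (Λ / Ω)) ↔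
    A = 4 * Complex.I * b1 Ω Λ γ Q kt ∧ B = 4 * Complex.I * b2 Ω Λ γ Q kp := by
  have hΩ' : (Ω : ℂ) ≠ 0 := by exact_mod_cast hΩ
  have h0 : (γ : ℂ) ≠ 0 := by exact_mod_cast hγ₀
  have h1 : (γ - 1 : ℂ) ≠ 0 := by rw [sub_ne_zero]; exact_mod_cast hγ₁
  have hα := one_sub_ne_zero γ Λ
  have hm := modeRatio_sub hΩ hγ₁ hkp hkt
  have hne : modeRatio Ω γ kt - modeRatio Ω γ kp ≠ 0 := by
    intro h
    rw [h, zero_mul] at hm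
    exact neg_ne_zero.2 (mul_ne_zero h0 hQ₀) hm.symm
  -- The explicit coefficients solve both equations by `modeRatio_sub`; uniqueness is then
  -- cancellation of m_t - m_p in the difference of two solutions.
  have s1 : Ω * (4 * Complex.I * b1 Ω Λ γ Q kt + 4 * Complex.I * b2 Ω Λ γ Q kp) = 1 := by
    rw [b1, b2]
    field_simp
    linear_combination (-1) * hm + (γ - 1) * (modeRatio Ω γ kt - modeRatio Ω γ kp) * Complex.I_sq
  have s2 : (1 - Complex.I * γ * Λ) * (4 * Complex.I * b1 Ω Λ γ Q kt * modeRatio Ω γ kp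
      + 4 * Complex.I * b2 Ω Λ γ Q kp * modeRatio Ω γ kt) = -Complex.I * γ * (Λ / Ω) := by
    rw [b1, b2]
    field_simp
    linear_combination (γ * Λ) * hm
  constructor
  · rintro ⟨w1, w2⟩
    have d1 : A + B = 4 * Complex.I * b1 Ω Λ γ Q kt + 4 * Complex.I * b2 Ω Λ γ Q kp :=
      mul_left_cancel₀ hΩ' (w1.trans s1.symm)
    have d2 := mul_left_cancel₀ hα (w2.trans s2.symm)
    have hB : B = 4 * Complex.I * b2 Ω Λ γ Q kp := by
      apply mul_left_cancel₀ hne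
      linear_combination d2 - modeRatio Ω γ kp * d1
    refine ⟨?_, hB⟩
    linear_combination d1 - hB
  · rintro ⟨rfl, rfl⟩
    exact ⟨s1, s2⟩

/-- Boundedness removes the `j`-modes, and the source conditions determine a σ(k_p) and b σ(k_t);
dividing by the nonzero σ gives the amplitudes. -/
theorem IsRadialHelmholtzPair.isFreeSpaceGreen_iff {j h σ : ℂ → ℂ}
    (H : IsRadialHelmholtzPair d j h σ) (hd : 1 ≤ d)
    (hΩ : Ω ≠ 0) (hγ₀ : γ ≠ 0) (hγ₁ : γ ≠ 1) (hQ₀ : Q ≠ 0)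
    (hQ : Q ^ 2 = 4 * (Complex.I * Ω + γ * Ω * Λ)
      + (1 - Complex.I * γ * Ω - Complex.I * Λ) ^ 2)
    (hkp : kp ^ 2 = acousticWavenumberSq Ω Λ γ Q) (hkt : kt ^ 2 = thermalWavenumberSq Ω Λ γ Q)
    (hkp_im : 0 < kp.im) (hkt_im : 0 < kt.im) (hσp : σ kp ≠ 0) (hσt : σ kt ≠ 0)
    (G : ℝ → ℂ × ℂ) :
    IsFreeSpaceGreen d Ω Λ γ (Submodule.span ℂ
        {mode Ω γ j kp, mode Ω γ h kp, mode Ω γ j kt, mode Ω γ h kt}) G ↔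
      G = modePair Ω γ kp kt h (4 * Complex.I * b1 Ω Λ γ Q kt / σ kp)
        (4 * Complex.I * b2 Ω Λ γ Q kp / σ kt) := by
  have h0 : (γ : ℂ) ≠ 0 := by exact_mod_cast hγ₀
  have hm := modeRatio_sub hΩ hγ₁ hkp hkt
  have hne : modeRatio Ω γ kt - modeRatio Ω γ kp ≠ 0 := by
    intro h
    rw [h, zero_mul] at hm
    exact neg_ne_zero.2 (mul_ne_zero h0 hQ₀) hm.symm
  have bp := H.bounded kp hkp_im
  have bt := H.bounded kt hkt_im
  have weak := H.isWeakDeltaSolution_iff hΩ hγ₀ hγ₁ hQ hkp hkt hkp_im hkt_im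
  constructor
  · rintro ⟨hU, hw, hT, hP⟩
    rw [boundedAtInfinity_radial_iff (f := fun r => (G r).1) hd] at hT
    rw [boundedAtInfinity_radial_iff (f := fun r => (G r).2) hd] at hP
    obtain ⟨a₁, _, hU₁, rfl⟩ := Submodule.mem_span_insert.1 hU
    obtain ⟨a₂, _, hU₂, rfl⟩ := Submodule.mem_span_insert.1 hU₁
    obtain ⟨a₃, _, hU₃, rfl⟩ := Submodule.mem_span_insert.1 hU₂
    obtain ⟨a₄, rfl⟩ := Submodule.mem_span_singleton.1 hU₃
    simp only [Pi.add_apply, Pi.smul_apply, mode, Prod.fst_add, Prod.snd_add, Prod.smul_fst,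
      Prod.smul_snd, smul_eq_mul] at hT hP
    have ha₁ : a₁ = 0 := by
      by_contra hne₁
      refine H.unbounded kp hkp_im ?_
      -- m_t T - P contains no k_t mode: it is (m_t - m_p)(a₁ j + a₂ h)(k_p r), and its h-part is
      -- bounded. P - m_p T does the same for k_t below.
      have h1 := ((hT.const_mul_left (modeRatio Ω γ kt)).sub hP).sub
        (bp.const_mul_left ((modeRatio Ω γ kt - modeRatio Ω γ kp) * a₂))
      refine (isBigO_const_mul_left_iff (mul_ne_zero hne hne₁)).1 (h1.congr_left fun r => ?_)
      ring
    have ha₃ : a₃ = 0 := by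
      by_contra hne₃
      refine H.unbounded kt hkt_im ?_
      have h1 := (hP.sub (hT.const_mul_left (modeRatio Ω γ kp))).sub
        (bt.const_mul_left ((modeRatio Ω γ kt - modeRatio Ω γ kp) * a₄))
      refine (isBigO_const_mul_left_iff (mul_ne_zero hne hne₃)).1 (h1.congr_left fun r => ?_)
      ring
    have hG : a₁ • mode Ω γ j kp + (a₂ • mode Ω γ h kp + (a₃ • mode Ω γ j kt + a₄ • mode Ω γ h kt))
        = modePair Ω γ kp kt h a₂ a₄ := by
      funext r
      simp only [ha₁, ha₃, zero_smul, zero_add, modePair, mode, Pi.add_apply, Pi.smul_apply]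
      refine Prod.ext ?_ ?_ <;> simp [mul_assoc]
    rw [hG] at hw ⊢
    obtain ⟨e1, e2⟩ := (source_conditions_iff hΩ hγ₀ hγ₁ hQ₀ hkp hkt).1 ((weak a₂ a₄).1 hw)
    rw [← e1, ← e2, mul_div_cancel_right₀ _ hσp, mul_div_cancel_right₀ _ hσt]
  · rintro rfl
    set a := 4 * Complex.I * b1 Ω Λ γ Q kt / σ kp with ha
    set b := 4 * Complex.I * b2 Ω Λ γ Q kp / σ kt with hb
    refine ⟨?_, (weak a b).2 ((source_conditions_iff hΩ hγ₀ hγ₁ hQ₀ hkp hkt).2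
      ⟨div_mul_cancel₀ _ hσp, div_mul_cancel₀ _ hσt⟩), ?_, ?_⟩
    · have hG : modePair Ω γ kp kt h a b = a • mode Ω γ h kp + b • mode Ω γ h kt := by
        funext r
        refine Prod.ext ?_ ?_ <;> simp [modePair, mode, mul_assoc]
      rw [hG]
      exact Submodule.add_mem _ (Submodule.smul_mem _ _ (Submodule.subset_span (by simp)))
        (Submodule.smul_mem _ _ (Submodule.subset_span (by simp)))
    · exact (boundedAtInfinity_radial_iff (f := fun r => (modePair Ω γ kp kt h a b r).1) hd).2
        ((bp.const_mul_left _).add (bt.const_mul_left _))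
    · exact (boundedAtInfinity_radial_iff (f := fun r => (modePair Ω γ kp kt h a b r).2) hd).2
        ((bp.const_mul_left _).add (bt.const_mul_left _))

/-! ### The two-dimensional pair -/

theorem hasDerivAt_mul_ofReal (k : ℂ) (r : ℝ) : HasDerivAt (fun r : ℝ => k * (r : ℂ)) k r := by
  simpa using (Complex.ofRealCLM.hasDerivAt (x := r)).const_mul k

theorem tendsto_ray (hk : 0 < k.im) :
    Tendsto (fun r : ℝ => k * (r : ℂ)) (𝓝[>] 0) (𝓝[upperHalf] 0) := by
  refine tendsto_nhdsWithin_iff.2 ⟨?_, ?_⟩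
  · have h : Continuous fun r : ℝ => k * (r : ℂ) := by fun_prop
    have := h.tendsto 0
    simp only [Complex.ofReal_zero, mul_zero] at this
    exact this.mono_left nhdsWithin_le_nhds
  · filter_upwards [self_mem_nhdsWithin] with r hr using mul_mem_upperHalf hk hr

theorem isRadialHelmholtzPair_two :
    IsRadialHelmholtzPair 2 besselJ0 hankelH0 fun _ => 4 * Complex.I := by
  have hder : ∀ k : ℂ, 0 < k.im → ∀ r : ℝ, 0 < r →
      HasDerivAt (fun r : ℝ => hankelH0 (k * r)) (k * hankelH0Deriv (k * r)) r := by
    intro k hk r hr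
    convert! HasDerivAt.comp r (hasDerivAt_hankelH0 (z := k * r) (mul_mem_upperHalf hk hr))
      (hasDerivAt_mul_ofReal k r) using 1
    ring
  have hO : ∀ k : ℂ, 0 < k.im →
      (fun r : ℝ => r * hankelH0 (k * r)) =O[𝓝[>] 0] fun _ => (1 : ℝ) := by
    intro k hk
    have h := ((tendsto_mul_hankelH0.comp (tendsto_ray hk)).const_mul k⁻¹).isBigO_one ℝ
    refine h.congr_left fun r => ?_
    have := ne_zero_of_im_pos hk
    simp only [Function.comp]
    field_simp
  refine ⟨fun k hk => ?_, fun k hk φ hφ hφs => ?_, fun k hk => ?_, fun k hk h => ?_⟩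
  · exact locallyIntegrable_radial le_rfl
      (fun r hr => (hder k hk r hr).continuousAt.continuousWithinAt) (hO k hk)
  · have hk0 := ne_zero_of_im_pos hk
    -- The value c = 2i/π is the limit of z H₀⁽¹⁾'(z); times the circumference 2π it gives the mass
    -- 4i, independent of k.
    have h := integral_radial_mul_helmholtz (d := 2) le_rfl (k := k) (c := 2 * Complex.I / Real.pi)
      (hder k hk) (fun r hr => ?_) (hO k hk) ?_ hφ hφs
    · rw [h, measureReal_def, EuclideanSpace.volume_ball_fin_two]
      have : (Real.pi : ℂ) ≠ 0 := by exact_mod_cast Real.pi_ne_zero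
      simp only [ENNReal.ofReal_one, one_pow, one_mul, ENNReal.toReal_ofReal Real.pi_pos.le]
      push_cast
      field_simp
      ring
    · have hr0 : (r : ℂ) ≠ 0 := by exact_mod_cast hr.ne'
      convert! (HasDerivAt.comp r (hasDerivAt_hankelH0Deriv (z := k * r) (mul_mem_upperHalf hk hr))
        (hasDerivAt_mul_ofReal k r)).const_mul k using 1
      push_cast
      field_simp
      ring
    · refine (tendsto_mul_hankelH0Deriv.comp (tendsto_ray hk)).congr fun r => ?_
      simp only [Function.comp]
      ring
  · obtain ⟨C, hC0, hC⟩ := norm_hankelH0_ray_le hk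
    refine IsBigO.of_bound C ?_
    filter_upwards [eventually_ge_atTop 1] with r hr
    refine (hC r hr).trans ?_
    simp only [norm_one]
    refine mul_le_mul_of_nonneg_left (Real.exp_le_one_iff.2 ?_) hC0
    have : 0 ≤ k.im * r := mul_nonneg hk.le (by linarith)
    linarith
  · obtain ⟨C, hC⟩ := h.bound
    simp only [norm_one, mul_one] at hC
    exact not_bounded_besselJ0_ray hk C hC

/-! ### The three-dimensional pair -/

theorem sphHankelH0_eq (z : ℂ) : sphHankelH0 z = -Complex.I * (Complex.exp (Complex.I * z) / z) := by
  rw [sphHankelH0, sphBesselJ0, sphBesselY0, mul_comm Complex.I z, Complex.exp_mul_I]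
  linear_combination (Complex.sin z / z) * Complex.I_sq

theorem hasDerivAt_sphHankelH0 {z : ℂ} (hz : z ≠ 0) :
    HasDerivAt sphHankelH0 (-Complex.I * (Complex.exp (Complex.I * z) * (Complex.I * z - 1)
      / z ^ 2)) z := by
  rw [show sphHankelH0 = _ from funext sphHankelH0_eq]
  convert! ((((hasDerivAt_id z).const_mul Complex.I).cexp).div (hasDerivAt_id z) hz).const_mul
    (-Complex.I) using 1
  simp only [id]
  ring

theorem isRadialHelmholtzPair_three :
    IsRadialHelmholtzPair 3 sphBesselJ0 sphHankelH0 fun k => 4 * Real.pi * Complex.I / k := by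
  have hder : ∀ k : ℂ, 0 < k.im → ∀ r : ℝ, 0 < r →
      HasDerivAt (fun r : ℝ => sphHankelH0 (k * r)) (-Complex.I *
        (Complex.exp (Complex.I * (k * r)) * (Complex.I * (k * r) - 1) / (k * r ^ 2))) r := by
    intro k hk r hr
    have hk0 := ne_zero_of_im_pos hk
    have hr0 : (r : ℂ) ≠ 0 := by exact_mod_cast hr.ne'
    convert! HasDerivAt.comp r (hasDerivAt_sphHankelH0
      (mul_ne_zero hk0 hr0))
      (hasDerivAt_mul_ofReal k r) using 1
    field_simp
  have hO : ∀ k : ℂ, 0 < k.im →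
      (fun r : ℝ => r * sphHankelH0 (k * r)) =O[𝓝[>] 0] fun _ => (1 : ℝ) := by
    intro k hk
    have hc : Continuous fun r : ℝ => -Complex.I / k * Complex.exp (Complex.I * (k * r)) := by
      fun_prop
    refine (((hc.tendsto 0).mono_left nhdsWithin_le_nhds).isBigO_one ℝ).congr' ?_
      EventuallyEq.rfl
    filter_upwards [self_mem_nhdsWithin] with r hr
    have hk0 := ne_zero_of_im_pos hk
    have hr0 : (r : ℂ) ≠ 0 := by exact_mod_cast (ne_of_gt hr)
    rw [sphHankelH0_eq]
    field_simp
  refine ⟨fun k hk => ?_, fun k hk φ hφ hφs => ?_, fun k hk => ?_, fun k hk h => ?_⟩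
  · exact locallyIntegrable_radial (by norm_num)
      (fun r hr => (hder k hk r hr).continuousAt.continuousWithinAt) (hO k hk)
  · have hk0 := ne_zero_of_im_pos hk
    -- Here r² d/dr h₀⁽¹⁾(kr) → i/k, and the sphere has area 4π, so the mass is 4πi/k.
    have h := integral_radial_mul_helmholtz (d := 3) (by norm_num) (k := k) (c := Complex.I / k)
      (hder k hk) (fun r hr => ?_) (hO k hk) ?_ hφ hφs
    · rw [h, measureReal_def, EuclideanSpace.volume_ball_fin_three]
      have : 0 ≤ Real.pi * 4 / 3 := by positivity
      rw [ENNReal.toReal_mul, ENNReal.toReal_ofReal this]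
      simp only [ENNReal.ofReal_one, one_pow, ENNReal.toReal_one, one_mul]
      push_cast
      field_simp
    · have hr0 : (r : ℂ) ≠ 0 := by exact_mod_cast hr.ne'
      have hl := (hasDerivAt_mul_ofReal k r).const_mul Complex.I
      have hp : HasDerivAt (fun r : ℝ => k * (r : ℂ) ^ 2) (k * (2 * r)) r := by
        simpa using (((Complex.ofRealCLM.hasDerivAt (x := r)).pow 2)).const_mul k
      convert! ((hl.cexp.mul (hl.sub_const 1)).div hp
        (mul_ne_zero hk0 (pow_ne_zero 2 hr0))).const_mul (-Complex.I) using 1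
      rw [sphHankelH0_eq]
      push_cast
      simp only [Pi.mul_apply]
      field_simp
      ring_nf
      simp only [Complex.I_sq]
      ring
    · have hc : Continuous fun r : ℝ => -Complex.I / k *
          (Complex.exp (Complex.I * (k * r)) * (Complex.I * (k * r) - 1)) := by fun_prop
      have hlim := (hc.tendsto 0).mono_left (nhdsWithin_le_nhds (s := Ioi 0))
      have e : -Complex.I / k * (Complex.exp (Complex.I * (k * (0 : ℝ)))
          * (Complex.I * (k * (0 : ℝ)) - 1)) = Complex.I / k := by
        simp
        ring
      rw [e] at hlim
      refine hlim.congr' ?_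
      filter_upwards [self_mem_nhdsWithin] with r hr
      have hr0 : (r : ℂ) ≠ 0 := by exact_mod_cast (ne_of_gt hr)
      simp only [Nat.reduceSub]
      field_simp
  · refine IsBigO.of_bound ‖k‖⁻¹ ?_
    filter_upwards [eventually_ge_atTop 1] with r hr
    have hn : 0 < ‖k‖ := norm_pos_iff.2 (ne_zero_of_im_pos hk)
    have he : ‖Complex.exp (Complex.I * (k * r))‖ ≤ 1 := by
      rw [Complex.norm_exp, Real.exp_le_one_iff]
      have : 0 ≤ k.im * r := mul_nonneg hk.le (by linarith)
      simpa using this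
    rw [sphHankelH0_eq, norm_mul, norm_neg, Complex.norm_I, one_mul, norm_div, norm_mul,
      Complex.norm_real, Real.norm_of_nonneg (by linarith : (0 : ℝ) ≤ r), norm_one, mul_one,
      div_le_iff₀ (by positivity)]
    refine he.trans ?_
    rw [inv_mul_cancel_left₀ hn.ne']
    exact hr
  · obtain ⟨C, hC⟩ := h.bound
    simp only [norm_one, mul_one] at hC
    have hn : 0 < ‖k‖ := norm_pos_iff.2 (ne_zero_of_im_pos hk)
    have hle : ∀ᶠ r : ℝ in atTop, Real.exp (k.im * r) / r ^ 1 ≤ 2 * C * ‖k‖ + 1 := by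
      filter_upwards [hC, eventually_ge_atTop 1] with r hr hr1
      have hr0 : 0 < r := by linarith
      rw [sphBesselJ0, norm_div, norm_mul, Complex.norm_real, Real.norm_of_nonneg hr0.le,
        div_le_iff₀ (by positivity)] at hr
      -- Since e^{-ikr} has modulus e^{r Im k} and e^{ikr} is bounded by 1, a bound on sin(kr)/(kr)
      -- would force e^{r Im k}/r to stay bounded.
      have hs : Complex.exp (-(k * r) * Complex.I)
          = -2 * Complex.I * Complex.sin (k * r) + Complex.exp (k * r * Complex.I) := by
        rw [Complex.sin]
        linear_combination (Complex.exp (-(k * r) * Complex.I)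
          - Complex.exp (k * r * Complex.I)) * Complex.I_sq
      have n1 : ‖Complex.exp (-(k * r) * Complex.I)‖ = Real.exp (k.im * r) := by
        rw [Complex.norm_exp]; simp
      have n2 : ‖Complex.exp (k * r * Complex.I)‖ ≤ 1 := by
        rw [Complex.norm_exp, Real.exp_le_one_iff]
        have : 0 ≤ k.im * r := mul_nonneg hk.le hr0.le
        simpa using this
      have n3 : ‖-2 * Complex.I * Complex.sin (k * r)‖ = 2 * ‖Complex.sin (k * r)‖ := by
        simp
      have hadd := norm_add_le (-2 * Complex.I * Complex.sin (k * r))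
        (Complex.exp (k * r * Complex.I))
      rw [← hs, n1, n3] at hadd
      rw [pow_one, div_le_iff₀ hr0]
      nlinarith
    have hlim := tendsto_exp_mul_div_rpow_atTop 1 k.im hk
    obtain ⟨r, hr1, hr2⟩ := (hle.and (hlim.eventually_gt_atTop (2 * C * ‖k‖ + 1))).exists
    rw [Real.rpow_one] at hr2
    rw [pow_one] at hr1
    linarith

end MorseIngard

/-! ### Specialization to dimensions two and three. -/

theorem mainTheorem4 (Ω Λ γ : ℝ) (Q kp kt : ℂ)
    (hΩ : Ω ≠ 0) (hγ₀ : γ ≠ 0) (hγ₁ : γ ≠ 1)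
    (hQ : Q ^ 2 = 4 * (Complex.I * Ω + γ * Ω * Λ)
      + (1 - Complex.I * γ * Ω - Complex.I * Λ) ^ 2)
    (hQ₀ : Q ≠ 0)
    (hkp : kp ^ 2 = MorseIngard.acousticWavenumberSq Ω Λ γ Q)
    (hkt : kt ^ 2 = MorseIngard.thermalWavenumberSq Ω Λ γ Q)
    (hkp_im : 0 < kp.im) (hkt_im : 0 < kt.im) :
    (∀ G : ℝ → ℂ × ℂ,
      MorseIngard.IsFreeSpaceGreen 2 Ω Λ γ (MorseIngard.U2 Ω γ kp kt) G ↔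
        G = MorseIngard.green2 Ω Λ γ Q kp kt) ∧
    (∀ G : ℝ → ℂ × ℂ,
      MorseIngard.IsFreeSpaceGreen 3 Ω Λ γ (MorseIngard.U3 Ω γ kp kt) G ↔
        G = MorseIngard.green3 Ω Λ γ Q kp kt) := by
  have hkp0 := MorseIngard.ne_zero_of_im_pos hkp_im
  have hkt0 := MorseIngard.ne_zero_of_im_pos hkt_im
  have hpi : (Real.pi : ℂ) ≠ 0 := by exact_mod_cast Real.pi_ne_zero
  have h4 : (4 * Complex.I : ℂ) ≠ 0 := by simp
  have h3 : ∀ k : ℂ, k ≠ 0 → (4 * Real.pi * Complex.I / k : ℂ) ≠ 0 := fun k hk => by simp [hpi, hk]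
  constructor
  · intro G
    rw [MorseIngard.U2, MorseIngard.isRadialHelmholtzPair_two.isFreeSpaceGreen_iff (by norm_num) hΩ
      hγ₀ hγ₁ hQ₀ hQ hkp hkt hkp_im hkt_im h4 h4, mul_div_cancel_left₀ _ h4,
      mul_div_cancel_left₀ _ h4]
    rfl
  · intro G
    rw [MorseIngard.U3, MorseIngard.isRadialHelmholtzPair_three.isFreeSpaceGreen_iff (by norm_num) hΩ
      hγ₀ hγ₁ hQ₀ hQ hkp hkt hkp_im hkt_im (h3 kp hkp0) (h3 kt hkt0)]
    -- Replacing the planar mass 4i by 4πi/k multiplies the amplitude by k/π, which is the ratio of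
    -- the 3D to the 2D coefficients.
    have e1 : 4 * Complex.I * MorseIngard.b1 Ω Λ γ Q kt / (4 * Real.pi * Complex.I / kp)
        = MorseIngard.c1 Ω Λ γ Q kp kt := by
      rw [MorseIngard.b1, MorseIngard.c1]
      field_simp
    have e2 : 4 * Complex.I * MorseIngard.b2 Ω Λ γ Q kp / (4 * Real.pi * Complex.I / kt)
        = MorseIngard.c2 Ω Λ γ Q kp kt := by
      rw [MorseIngard.b2, MorseIngard.c2]
      field_simp
    rw [e1, e2]
    rfl
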